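/- **Theorem 4.1 (Bayesian regression: $V$ unknown).** *Laws.* Matrices are real; $|\cdot|$ is the determinant, and each law below is the probability measure whose density is proportional to the displayed function. For symmetric positive definite $V\in\mathbb R^{m\times m}$, $K\in\mathbb R^{n\times n}$, the matrix-normal law $\mathcal N(M,V,K)$ on $\mathbb R^{m\times n}$ has Lebesgue density $\propto |V|^{-n/2}|K|^{-m/2}\exp(-\tfrac12\operatorname{tr}V^{-1}(A-M)K^{-1}(A-M)^\top)$. For $\delta>0$ and symmetric positive definite $\Sigma,\Omega$, the matrix-T law $\mathcal T(M,\Sigma,\Omega,\delta)$ on $\mathbb R^{m\times n}$ has Lebesgue density $\propto|\Sigma|^{-n/2}|\Omega|^{-m/2}|I_m+\Sigma^{-1}(T-M)\Omega^{-1}(T-M)^\top|^{-(\delta+n+m-1)/2}$. For $\nu>2m$ and symmetric positive definite $\Psi\in\mathbb R^{m\times m}$, the inverse Wishart law $\mathrm{IW}(\Psi,\nu)$ has density $\propto|\Psi|^{(\nu-m-1)/2}|V|^{-\nu/2}\exp(-\tfrac12\operatorname{tr}V^{-1}\Psi)$ with respect to $\prod_{i\le j}dV_{ij}$ on the symmetric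 positive definite matrices. *Model.* Let $\phi:\mathbb R^{d}\to\mathbb R^{q}$ and $\sigma:\mathbb R^d\to(0,\infty)$, let $x_1,\dots,x_N$ (observed) and $x^*_1,\dots,x^*_L$ (new) be points of $\mathbb R^d$, and put $\Phi=[\phi(x_1)\cdots\phi(x_N)]$, $D=\operatorname{diag}(\sigma^2(x_i))$, $\Phi_*=[\phi(x^*_1)\cdots\phi(x^*_L)]$, $D_*=\operatorname{diag}(\sigma^2(x^*_i))$. Let $M\in\mathbb R^{p\times q}$, let $K\in\mathbb R^{q\times q}$ and $\Psi\in\mathbb R^{p\times p}$ be symmetric positive definite, and $\nu>2p$ real. Let $V,A,Y,Y_*$ be random matrices of sizes $p\times p$, $p\times q$, $p\times N$, $p\times L$ with $$V\sim\mathrm{IW}(\Psi,\nu),\quad A\mid V\sim\mathcal N(M,V,K),\quad Y\mid A,V\sim\mathcal N(A\Phi,V,D),\quad Y_*\mid A,V,Y\sim\mathcal N(A\Phi_*,V,D_*).$$ Put $P_{xx}=D+\Phi^\top K\Phi$, $S_{xx}=K^{-1}+\Phi D^{-1}\Phi^\top$, $S_{yx}=YD^{-1}\Phi^\top+MK^{-1}$,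 $S_{yy}=YD^{-1}Y^\top+MK^{-1}M^\top$, $S_{y|x}=S_{yy}-S_{yx}S_{xx}^{-1}S_{yx}^\top$ and $S_{y|x,a}=S_{yy}+AS_{xx}A^\top-(S_{yx}A^\top+AS_{yx}^\top)$. Then (conditional laws being understood for almost every value of the conditioning variables): 1. $[A\ Y]\sim\mathcal T\!\left([M\ \ M\Phi],\Psi,\begin{bmatrix}K&K\Phi\\ \Phi^\top K&P_{xx}\end{bmatrix},\nu-2p\right)$. 2. $Y\sim\mathcal T(M\Phi,\Psi,P_{xx},\nu-2p)$ and $A\sim\mathcal T(M,\Psi,K,\nu-2p)$. 3. The posterior of $(A,V)$ given $Y$ is the compound normal-inverse Wishart law whose density is the product of the densities of $\mathcal N(S_{yx}S_{xx}^{-1},V,S_{xx}^{-1})$ at $A$ and of $\mathrm{IW}(\Psi+S_{y|x},\nu+N)$ at $V$, with marginals $$A\mid Y\sim\mathcal T(S_{yx}S_{xx}^{-1},\Psi+S_{y|x},S_{xx}^{-1},\nu+N-2p),\qquad V\mid Y\sim\mathrm{IW}(\Psi+S_{y|x},\nu+N).$$ Moreover $A\mid Y,V\sim\mathcal N(S_{yx}S_{xx}^{-1},V,S_{xx}^{-1})$,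 which is the same as the posterior of $A$ given $Y$ in the model $A\sim\mathcal N(M,V,K)$, $Y\mid A\sim\mathcal N(A\Phi,V,D)$ with $V$ a known symmetric positive definite matrix; and $V\mid Y,A\sim\mathrm{IW}(\Psi+S_{y|x,a},\nu+N+q)$. 4. $Y_*\mid Y\sim\mathcal T(S_{yx}S_{xx}^{-1}\Phi_*,\ \Psi+S_{y|x},\ D_*+\Phi_*^\top S_{xx}^{-1}\Phi_*,\ \nu+N-2p)$. Moreover $$Y_*\mid Y,A\sim\mathcal T(A\Phi_*,\Psi+S_{y|x,a},D_*,\nu+N+q-2p),$$ $$Y_*\mid A\sim\mathcal T(A\Phi_*,\Psi+(A-M)K^{-1}(A-M)^\top,D_*,\nu+q-2p),$$ and, when $p,N,L\ge1$, these last two conditional laws are almost surely different. -/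

import Mathlib

open MeasureTheory ProbabilityTheory Matrix

noncomputable section

namespace BLR

section Instances

variable {m n : Type*}

/-- The entrywise (product) sigma-algebra on real matrices. -/
instance instMeasurableSpaceMatrix : MeasurableSpace (Matrix m n ℝ) :=
  inferInstanceAs (MeasurableSpace (m → n → ℝ))

/-- Lebesgue measure on real matrices: the product of the Lebesgue measures of all entries. -/
instance instMeasureSpaceMatrix [Fintype m] [Fintype n] : MeasureSpace (Matrix m n ℝ) where
  toMeasurableSpace := instMeasurableSpaceMatrix
  volume := (volume : Measure (m → n → ℝ))

instance instStandardBorelSpaceMatrix [Countable m] [Countable n] :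
    StandardBorelSpace (Matrix m n ℝ) :=
  inferInstanceAs (StandardBorelSpace (m → n → ℝ))

end Instances

section Laws

/-- The probability measure whose density with respect to `μ` is proportional to `f`
(for `f ≥ 0` with finite, nonzero integral). -/
def propTo {α : Type*} [MeasurableSpace α] (μ : Measure α) (f : α → ℝ) : Measure α :=
  (∫⁻ a, ENNReal.ofReal (f a) ∂μ)⁻¹ • μ.withDensity (fun a => ENNReal.ofReal (f a))

/-- `HasCondLaw Y X κ P`: under `P`, the conditional law of `Y` given `X = x` is `κ x`, for almost
every value `x` of `X`. -/
def HasCondLaw {Ω α β : Type*} [MeasurableSpace Ω] [MeasurableSpace α] [MeasurableSpace β]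
    [StandardBorelSpace β] [Nonempty β] (Y : Ω → β) (X : Ω → α) (κ : α → Measure β)
    (P : Measure Ω) [IsFiniteMeasure P] : Prop :=
  AEMeasurable X P ∧ AEMeasurable Y P ∧ ∀ᵐ x ∂(P.map X), condDistrib Y X P x = κ x

variable {m n : Type*} [Fintype m] [Fintype n] [DecidableEq m] [DecidableEq n]

/-- Density of the matrix-normal law `N(M, V, K)`, up to a constant depending only on the
dimensions. Here `V` is the row covariance and `K` the column covariance. -/
def matrixNormalDensity (M : Matrix m n ℝ) (V : Matrix m m ℝ) (K : Matrix n n ℝ)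
    (A : Matrix m n ℝ) : ℝ :=
  V.det ^ (-(Fintype.card n : ℝ) / 2) * K.det ^ (-(Fintype.card m : ℝ) / 2) *
    Real.exp (-(1 / 2) * (V⁻¹ * (A - M) * K⁻¹ * (A - M)ᵀ).trace)

/-- The matrix-normal law `N(M, V, K)`. -/
def matrixNormal (M : Matrix m n ℝ) (V : Matrix m m ℝ) (K : Matrix n n ℝ) :
    Measure (Matrix m n ℝ) :=
  propTo volume (matrixNormalDensity M V K)

/-- Density of the matrix-T law `T(M, S, R, δ)`, up to a constant depending only on the
dimensions and on `δ`. -/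
def matrixTDensity (M : Matrix m n ℝ) (S : Matrix m m ℝ) (R : Matrix n n ℝ) (δ : ℝ)
    (T : Matrix m n ℝ) : ℝ :=
  S.det ^ (-(Fintype.card n : ℝ) / 2) * R.det ^ (-(Fintype.card m : ℝ) / 2) *
    (1 + S⁻¹ * (T - M) * R⁻¹ * (T - M)ᵀ).det ^
      (-((δ + Fintype.card n + Fintype.card m - 1) / 2))

/-- The matrix-T law with mean `M`, row covariance `S`, column covariance `R` and `δ` degrees of
freedom. -/
def matrixT (M : Matrix m n ℝ) (S : Matrix m m ℝ) (R : Matrix n n ℝ) (δ : ℝ) :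
    Measure (Matrix m n ℝ) :=
  propTo volume (matrixTDensity M S R δ)

/-- The symmetric matrix with entry `x {i, j}` at `(i, j)` and at `(j, i)`. -/
def symOf (x : Sym2 m → ℝ) : Matrix m m ℝ := Matrix.of fun i j => x s(i, j)

/-- Lebesgue measure `∏_{i ≤ j} dv_ij` on the symmetric matrices, restricted to the cone of
positive definite ones. -/
def posDefVolume : Measure (Matrix m m ℝ) :=
  ((volume : Measure (Sym2 m → ℝ)).map symOf).restrict {V | V.PosDef}

/-- Density of the inverse Wishart law `IW(Ψ, ν)` at a positive definite `V`, up to a constant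
depending only on the dimension and on `ν`. -/
def inverseWishartDensity (Ψ : Matrix m m ℝ) (ν : ℝ) (V : Matrix m m ℝ) : ℝ :=
  Ψ.det ^ ((ν - Fintype.card m - 1) / 2) * V.det ^ (-ν / 2) *
    Real.exp (-(1 / 2) * (V⁻¹ * Ψ).trace)

/-- The inverse Wishart law `IW(Ψ, ν)`. -/
def inverseWishart (Ψ : Matrix m m ℝ) (ν : ℝ) : Measure (Matrix m m ℝ) :=
  propTo posDefVolume (inverseWishartDensity Ψ ν)

/-- The compound normal-inverse Wishart law `N(M, V, K) ⊗ IW(Ψ, ν)` of a pair `(A, V)`: its density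
is the product of the matrix-normal density of `A` given `V` and of the inverse Wishart density of
`V` (their omitted normalizing constants do not depend on `(A, V)`). -/
def normalInverseWishart (M : Matrix m n ℝ) (K : Matrix n n ℝ) (Ψ : Matrix m m ℝ) (ν : ℝ) :
    Measure (Matrix m n ℝ × Matrix m m ℝ) :=
  propTo ((volume : Measure (Matrix m n ℝ)).prod posDefVolume)
    (fun z => matrixNormalDensity M z.2 K z.1 * inverseWishartDensity Ψ ν z.2)

end Laws

section Symbols

variable {𝒳 : Type*} {p q N : ℕ}

/-- The matrix `Φ` whose columns are the feature vectors `φ (x i)`. -/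
def featureMatrix (φ : 𝒳 → EuclideanSpace ℝ (Fin q)) (x : Fin N → 𝒳) :
    Matrix (Fin q) (Fin N) ℝ :=
  Matrix.of fun k i => φ (x i) k

/-- The diagonal matrix `D` of the noise variances `σ² (x i)`. -/
def noiseMatrix (σ : 𝒳 → ℝ) (x : Fin N → 𝒳) : Matrix (Fin N) (Fin N) ℝ :=
  Matrix.diagonal fun i => σ (x i) ^ 2

variable (M : Matrix (Fin p) (Fin q) ℝ) (K : Matrix (Fin q) (Fin q) ℝ)
  (Φ : Matrix (Fin q) (Fin N) ℝ) (D : Matrix (Fin N) (Fin N) ℝ)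

/-- `D + Φᵀ K Φ`. -/
def Pxx : Matrix (Fin N) (Fin N) ℝ := D + Φᵀ * K * Φ

/-- The column covariance of `[A Y]`. -/
def jointCov : Matrix (Fin q ⊕ Fin N) (Fin q ⊕ Fin N) ℝ :=
  Matrix.fromBlocks K (K * Φ) (Φᵀ * K) (Pxx K Φ D)

/-- `S_xx = K⁻¹ + Φ D⁻¹ Φᵀ`. -/
def Sxx : Matrix (Fin q) (Fin q) ℝ := K⁻¹ + Φ * D⁻¹ * Φᵀ

/-- `S_yx = Y D⁻¹ Φᵀ + M K⁻¹`. -/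
def Syx (Y : Matrix (Fin p) (Fin N) ℝ) : Matrix (Fin p) (Fin q) ℝ :=
  Y * D⁻¹ * Φᵀ + M * K⁻¹

/-- `S_yy = Y D⁻¹ Yᵀ + M K⁻¹ Mᵀ`. -/
def Syy (Y : Matrix (Fin p) (Fin N) ℝ) : Matrix (Fin p) (Fin p) ℝ :=
  Y * D⁻¹ * Yᵀ + M * K⁻¹ * Mᵀ

/-- `S_{y|x} = S_yy - S_yx S_xx⁻¹ S_yxᵀ`. -/
def Sycx (Y : Matrix (Fin p) (Fin N) ℝ) : Matrix (Fin p) (Fin p) ℝ :=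
  Syy M K D Y - Syx M K Φ D Y * (Sxx K Φ D)⁻¹ * (Syx M K Φ D Y)ᵀ

/-- `S_{y|x,a} = S_yy + A S_xx Aᵀ - (S_yx Aᵀ + A S_yxᵀ)`. -/
def Sycxa (Y : Matrix (Fin p) (Fin N) ℝ) (A : Matrix (Fin p) (Fin q) ℝ) :
    Matrix (Fin p) (Fin p) ℝ :=
  Syy M K D Y + A * Sxx K Φ D * Aᵀ - (Syx M K Φ D Y * Aᵀ + A * (Syx M K Φ D Y)ᵀ)

end Symbols

end BLR

end

open BLR

/-! Up to factors free of the variables at play, every normal and inverse Wishart density of the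
model is a value of one function, `wishartKernel r S v`, which is |v|^(-r/2) exp(-tr(v⁻¹S)/2).
Multiplying kernels adds the exponents `r` and the matrices `S` (`wishartKernel_mul`), so the joint
density of all the random matrices is again a kernel, with `S` equal to Ψ plus a sum of quadratic
forms.

Two integrals give all marginals. A matrix a with n columns that enters `S` through (a - B) R (a -
B)ᵀ integrates out to a constant and lowers `r` by n (`lintegral_wishartKernel_add_quadratic`).
Integrating over v leaves a power of |S|, which is a matrix-T density (`lintegral_wishartKernel`).
Both come from a factorization C Cᵀ and a linear substitution whose Jacobian is a power of |C|.

The rest is algebra: S_{y|x,a} is the prior form plus the likelihood form (`Sycxa_eq_add`),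
completing the square in a splits off S_{y|x} (`Sycxa_eq_Sycx_add`), and Woodbury's identity turns
S_{y|x} into a form in the residual y - MΦ (`Sycx_eq`). For the posterior predictive law the same
identities are applied with the posterior in the role of the prior.

No normalizing constant is evaluated. Densities are tracked up to an unspecified constant, which
total mass one determines, and a conditional law is read off a joint density by freezing one
variable (`HasDensityPropTo.hasCondLaw`). The last two predictive laws differ because their degrees
of freedom differ by N, and a matrix-T density restricted to a line through its centre reveals its
degrees of freedom (`matrixT_ne`). -/

namespace BLR

open scoped ENNReal

/-! ### Calculus of densities known up to a constant. -/

section Density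

variable {Ω α β γ : Type*} [MeasurableSpace Ω] [MeasurableSpace α] [MeasurableSpace β]
  [MeasurableSpace γ] {P : Measure Ω} {μ : Measure α} {lam : Measure β}

/-- Under `P`, the law of `W` has a density with respect to `μ` which is proportional to the
measurable function `F`. -/
structure HasDensityPropTo (W : Ω → α) (μ : Measure α) (F : α → ℝ) (P : Measure Ω) : Prop where
  aemeasurable : AEMeasurable W P
  measurable : Measurable F
  exists_const : ∃ c : ℝ≥0∞, P.map W = c • μ.withDensity (fun a => ENNReal.ofReal (F a))

/-- The factor `c` cancels against the normalization. As `c` is neither 0 nor ∞ this is valid even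
when the integral is degenerate, so integrability is never needed. -/
lemma propTo_congr_of_pos {f g : α → ℝ} {c : ℝ} (hc : 0 < c) (h : ∀ᵐ a ∂μ, f a = c * g a) :
    propTo μ f = propTo μ g := by
  have h' : (fun a => ENNReal.ofReal (f a)) =ᵐ[μ]
      ENNReal.ofReal c • fun a => ENNReal.ofReal (g a) := by
    filter_upwards [h] with a ha
    simp [ha, ENNReal.ofReal_mul hc.le]
  have hc0 : ENNReal.ofReal c ≠ 0 := by simpa using hc
  have hct : ENNReal.ofReal c ≠ ∞ := ENNReal.ofReal_ne_top
  unfold propTo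
  rw [lintegral_congr_ae h', withDensity_congr_ae h', withDensity_smul' _ _ hct, smul_smul]
  congr 1
  simp only [Pi.smul_apply, smul_eq_mul]
  rw [lintegral_const_mul' _ _ hct, ENNReal.mul_inv (Or.inl hc0) (Or.inl hct), mul_right_comm,
    ENNReal.inv_mul_cancel hc0 hct, one_mul]

lemma isProbabilityMeasure_propTo {f : α → ℝ} (h0 : ∫⁻ a, ENNReal.ofReal (f a) ∂μ ≠ 0)
    (ht : ∫⁻ a, ENNReal.ofReal (f a) ∂μ ≠ ∞) : IsProbabilityMeasure (propTo μ f) := by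
  refine ⟨?_⟩
  simp [propTo, ENNReal.inv_mul_cancel h0 ht]

/-- If the integral were 0 or ∞, the total mass would be a product of 0 and ∞, hence 0 and not 1.
This gives finiteness without computing an integral. -/
lemma lintegral_ne_of_isProbabilityMeasure_propTo {f : α → ℝ}
    (h : IsProbabilityMeasure (propTo μ f)) :
    ∫⁻ a, ENNReal.ofReal (f a) ∂μ ≠ 0 ∧ ∫⁻ a, ENNReal.ofReal (f a) ∂μ ≠ ∞ := by
  have h1 := h.measure_univ
  simp only [propTo, Measure.smul_apply, withDensity_apply _ MeasurableSet.univ,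
    Measure.restrict_univ, smul_eq_mul] at h1
  constructor <;> intro h0 <;> simp [h0] at h1

namespace HasDensityPropTo

lemma hasLaw [IsProbabilityMeasure P] {W : Ω → α} {F : α → ℝ} (h : HasDensityPropTo W μ F P)
    {f : α → ℝ} {c : ℝ} (hc : 0 < c) (hf : ∀ᵐ a ∂μ, f a = c * F a) :
    HasLaw W (propTo μ f) P := by
  refine ⟨h.aemeasurable, ?_⟩
  rw [propTo_congr_of_pos hc hf]
  obtain ⟨k, hk⟩ := h.exists_const
  have h1 : (P.map W) Set.univ = 1 :=
    (Measure.isProbabilityMeasure_map h.aemeasurable).measure_univ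
  rw [hk] at h1 ⊢
  simp only [Measure.smul_apply, withDensity_apply _ MeasurableSet.univ,
    Measure.restrict_univ, smul_eq_mul] at h1
  -- Total mass one forces the unknown constant to be the inverse of the integral.
  rw [propTo, ENNReal.eq_inv_of_mul_eq_one_left h1]

lemma comp {W : Ω → α} {F : α → ℝ} (h : HasDensityPropTo W μ F P) {e : α → β} {G : β → ℝ}
    (he : MeasurePreserving e μ lam) (hG : Measurable G) (hFG : ∀ a, F a = G (e a)) :
    HasDensityPropTo (fun ω => e (W ω)) lam G P := by
  obtain ⟨k, hk⟩ := h.exists_const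
  refine ⟨he.measurable.comp_aemeasurable h.aemeasurable, hG, k, ?_⟩
  rw [← Function.comp_def, ← AEMeasurable.map_map_of_aemeasurable he.measurable.aemeasurable
    h.aemeasurable, hk, Measure.map_smul]
  congr 1
  ext s hs
  rw [Measure.map_apply he.measurable hs, withDensity_apply _ (he.measurable hs),
    withDensity_apply _ hs, ← he.map_eq, setLIntegral_map hs hG.ennreal_ofReal he.measurable]
  simp [hFG]

/-- Tonelli. The constant `C` ranges over [0, ∞], so the inner integral need not be known to be
finite. -/
lemma fst [SFinite μ] [SFinite lam] {W : Ω → α × β} {F : α × β → ℝ}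
    (h : HasDensityPropTo W (μ.prod lam) F P) {H : α → ℝ} (hH : Measurable H) {C : ℝ≥0∞}
    (hF : ∀ᵐ a ∂μ, ∫⁻ b, ENNReal.ofReal (F (a, b)) ∂lam = C * ENNReal.ofReal (H a)) :
    HasDensityPropTo (fun ω => (W ω).1) μ H P := by
  obtain ⟨k, hk⟩ := h.exists_const
  refine ⟨measurable_fst.comp_aemeasurable h.aemeasurable, hH, k * C, ?_⟩
  have : (fun ω => (W ω).1) = Prod.fst ∘ W := rfl
  rw [this, ← AEMeasurable.map_map_of_aemeasurable measurable_fst.aemeasurable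
    h.aemeasurable, hk, Measure.map_smul, ← smul_smul]
  congr 1
  ext s hs
  rw [Measure.map_apply measurable_fst hs, withDensity_apply _ (measurable_fst hs),
    Measure.smul_apply, withDensity_apply _ hs, ← Set.prod_univ, ← Measure.prod_restrict,
    Measure.restrict_univ, lintegral_prod _ h.measurable.ennreal_ofReal.aemeasurable, smul_eq_mul,
    ← lintegral_const_mul _ hH.ennreal_ofReal]
  exact lintegral_congr_ae (ae_restrict_of_ae hF)

/-- The joint law from the law of `X` and the conditional law of `Z` given `X`. -/
lemma prodMk [IsFiniteMeasure P] [StandardBorelSpace β] [Nonempty β] [SFinite μ] [SFinite lam]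
    {X : Ω → α} {Z : Ω → β} {F : α → ℝ} (hX : HasDensityPropTo X μ F P) {κ : α → Measure β}
    (hZ : HasCondLaw Z X κ P) {f : α × β → ℝ} (hf : Measurable f) {C : ℝ≥0∞}
    (hκ : ∀ᵐ x ∂μ, κ x = C • lam.withDensity fun z => ENNReal.ofReal (f (x, z)))
    {G : α × β → ℝ} (hG : Measurable G) {c : ℝ} (hc : 0 < c) (hF0 : ∀ᵐ x ∂μ, 0 ≤ F x)
    (hfG : ∀ᵐ x ∂μ, ∀ z, F x * f (x, z) = c * G (x, z)) :
    HasDensityPropTo (fun ω => (X ω, Z ω)) (μ.prod lam) G P := by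
  obtain ⟨k, hk⟩ := hX.exists_const
  refine ⟨hZ.1.prodMk hZ.2.1, hG, k * C * ENNReal.ofReal c, ?_⟩
  rw [← compProd_map_condDistrib hZ.2.1]
  have hac : P.map X ≪ μ := by
    rw [hk]; exact (withDensity_absolutelyContinuous _ _).smul_left _
  ext s hs
  have hs' : ∀ x, MeasurableSet (Prod.mk x ⁻¹' s) := fun x => measurable_prodMk_left hs
  have hm1 : Measurable fun p : α × β => s.indicator (fun p => ENNReal.ofReal (f p)) p :=
    hf.ennreal_ofReal.indicator hs
  have hm2 : Measurable fun p : α × β => s.indicator (fun p => ENNReal.ofReal (G p)) p :=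
    hG.ennreal_ofReal.indicator hs
  rw [Measure.compProd_apply hs, Measure.smul_apply, withDensity_apply _ hs,
    ← lintegral_indicator hs, lintegral_prod _ hm2.aemeasurable, smul_eq_mul, mul_assoc,
    mul_assoc, ← lintegral_const_mul _ hm2.lintegral_prod_right']
  -- The formula for `κ` holds `μ`-almost everywhere, hence almost everywhere for the law of `X`,
  -- which is absolutely continuous.
  have e1 : ∫⁻ x, condDistrib Z X P x (Prod.mk x ⁻¹' s) ∂(P.map X) =
      ∫⁻ x, C * ∫⁻ z, s.indicator (fun p => ENNReal.ofReal (f p)) (x, z) ∂lam ∂(P.map X) := by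
    refine lintegral_congr_ae ?_
    filter_upwards [hZ.2.2, hac.ae_le hκ] with x h1 h2
    rw [h1, h2, Measure.smul_apply, withDensity_apply _ (hs' x), ← lintegral_indicator (hs' x),
      smul_eq_mul]
    rfl
  rw [e1, hk, lintegral_smul_measure, lintegral_const_mul _ hm1.lintegral_prod_right', smul_eq_mul,
    lintegral_withDensity_eq_lintegral_mul _ hX.measurable.ennreal_ofReal
      hm1.lintegral_prod_right']
  congr 2
  refine lintegral_congr_ae ?_
  filter_upwards [hF0, hfG] with x h0 h1
  have hm1x : Measurable fun z => s.indicator (fun p => ENNReal.ofReal (f p)) (x, z) :=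
    hm1.comp measurable_prodMk_left
  have hm2x : Measurable fun z => s.indicator (fun p => ENNReal.ofReal (G p)) (x, z) :=
    hm2.comp measurable_prodMk_left
  rw [Pi.mul_apply, ← lintegral_const_mul _ hm1x, ← lintegral_const_mul _ hm2x]
  refine lintegral_congr fun z => ?_
  by_cases hz : (x, z) ∈ s
  · rw [Set.indicator_of_mem hz, Set.indicator_of_mem hz, ← ENNReal.ofReal_mul h0,
      ← ENNReal.ofReal_mul hc.le, h1]
  · rw [Set.indicator_of_notMem hz, Set.indicator_of_notMem hz, mul_zero, mul_zero]

/-- Bayes' rule: the conditional law of `Z` given `X` from their joint density. -/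
lemma hasCondLaw [IsProbabilityMeasure P] [StandardBorelSpace β] [Nonempty β] [SFinite μ]
    [SFinite lam] {X : Ω → α} {Z : Ω → β} {F : α × β → ℝ}
    (h : HasDensityPropTo (fun ω => (X ω, Z ω)) (μ.prod lam) F P) {κ : α → Measure β}
    (hκ : ∀ᵐ x ∂μ, propTo lam (fun z => F (x, z)) = κ x) : HasCondLaw Z X κ P := by
  have hXm : AEMeasurable X P := measurable_fst.comp_aemeasurable h.aemeasurable
  have hZm : AEMeasurable Z P := measurable_snd.comp_aemeasurable h.aemeasurable
  refine ⟨hXm, hZm, ?_⟩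
  obtain ⟨k, hk⟩ := h.exists_const
  set f : α × β → ℝ≥0∞ := fun p => ENNReal.ofReal (F p) with hf
  have hfm : Measurable f := h.measurable.ennreal_ofReal
  set I : α → ℝ≥0∞ := fun x => ∫⁻ z, f (x, z) ∂lam with hI
  have hIm : Measurable I := hfm.lintegral_prod_right'
  have hfx : ∀ x, Measurable fun z => f (x, z) := fun x => hfm.comp measurable_prodMk_left
  -- the law of `X`
  have hXlaw : P.map X = k • μ.withDensity I := by
    have h1 : P.map X = (P.map fun ω => (X ω, Z ω)).map Prod.fst := by
      rw [AEMeasurable.map_map_of_aemeasurable measurable_fst.aemeasurable h.aemeasurable]; rfl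
    rw [h1, hk, Measure.map_smul]
    congr 1
    ext s hs
    rw [Measure.map_apply measurable_fst hs, withDensity_apply _ (measurable_fst hs),
      withDensity_apply _ hs, ← Set.prod_univ, ← Measure.prod_restrict, Measure.restrict_univ,
      lintegral_prod _ hfm.aemeasurable]
  have hprob : IsProbabilityMeasure (P.map X) := Measure.isProbabilityMeasure_map hXm
  have hk1 : k * ∫⁻ x, I x ∂μ = 1 := by
    have := hprob.measure_univ
    rwa [hXlaw, Measure.smul_apply, withDensity_apply _ MeasurableSet.univ,
      Measure.restrict_univ, smul_eq_mul] at this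
  -- The relation `hk1` excludes an infinite integral of `I`: its product with `k` would be 0 or ∞.
  have hIt : ∀ᵐ x ∂μ, I x < ∞ := by
    refine ae_lt_top hIm fun h0 => ?_
    rw [h0] at hk1
    rcases eq_or_ne k 0 with rfl | hk0
    · simp at hk1
    · rw [ENNReal.mul_top hk0] at hk1; exact ENNReal.top_ne_one hk1
  have hac : P.map X ≪ μ := by
    rw [hXlaw]; exact (withDensity_absolutelyContinuous _ _).smul_left _
  have hI0 : ∀ᵐ x ∂(P.map X), I x ≠ 0 := by
    rw [hXlaw]
    refine Measure.ae_smul_measure ?_ k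
    rw [ae_withDensity_iff hIm]
    exact Filter.Eventually.of_forall fun x hx => hx
  -- the kernel
  classical
  -- On this set the sections of `F` can be normalized. Elsewhere, a null set for the law of `X`, a
  -- Dirac mass makes `K` a Markov kernel.
  let S : Set α := {x | I x ≠ 0 ∧ I x ≠ ∞}
  have hS : MeasurableSet S :=
    ((hIm (measurableSet_singleton 0)).compl).inter ((hIm (measurableSet_singleton ∞)).compl)
  let K : Kernel α β :=
    { toFun := fun x => if x ∈ S then (I x)⁻¹ • lam.withDensity (fun z => f (x, z))
        else Measure.dirac (Classical.arbitrary β)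
      measurable' := by
        refine Measurable.ite hS ?_ measurable_const
        refine Measure.measurable_of_measurable_coe _ fun s hs => ?_
        have : (fun x => ((I x)⁻¹ • lam.withDensity (fun z => f (x, z))) s) =
            fun x => (I x)⁻¹ * ∫⁻ z in s, f (x, z) ∂lam := by
          funext x
          rw [Measure.smul_apply, withDensity_apply _ hs, smul_eq_mul]
        rw [this]
        exact hIm.inv.mul hfm.lintegral_prod_right' }
  have hKS : ∀ x ∈ S, K x = propTo lam (fun z => F (x, z)) := fun x hx => if_pos hx
  have hKnS : ∀ x ∉ S, K x = Measure.dirac (Classical.arbitrary β) := fun x hx => if_neg hx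
  have : IsMarkovKernel K := by
    refine ⟨fun x => ?_⟩
    by_cases hx : x ∈ S
    · rw [hKS x hx]
      exact isProbabilityMeasure_propTo hx.1 hx.2
    · rw [hKnS x hx]; infer_instance
  have key : P.map (fun ω => (X ω, Z ω)) = P.map X ⊗ₘ K := by
    rw [hk, hXlaw]
    ext s hs
    have hs' : ∀ x, MeasurableSet (Prod.mk x ⁻¹' s) := fun x => measurable_prodMk_left hs
    rw [Measure.compProd_apply hs, Measure.smul_apply, withDensity_apply _ hs,
      ← lintegral_indicator hs, lintegral_prod _ (hfm.indicator hs).aemeasurable, smul_eq_mul,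
      lintegral_smul_measure, smul_eq_mul,
      lintegral_withDensity_eq_lintegral_mul _ hIm (Kernel.measurable_kernel_prodMk_left hs)]
    congr 1
    refine lintegral_congr_ae ?_
    filter_upwards [hIt] with x hx
    have e : ∫⁻ z, s.indicator (fun p => f p) (x, z) ∂lam =
        ∫⁻ z in Prod.mk x ⁻¹' s, f (x, z) ∂lam := by
      rw [← lintegral_indicator (hs' x)]; rfl
    rw [Pi.mul_apply]
    -- Where `I x = 0` the section of the joint density integrates to zero, so the arbitrary Dirac
    -- value does not matter.
    by_cases h0 : I x = 0
    · rw [h0, zero_mul]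
      refine le_antisymm ?_ (zero_le)
      calc _ ≤ I x := lintegral_mono fun z => Set.indicator_le_self _ _ _
        _ = 0 := h0
    · rw [hKS x ⟨h0, hx.ne⟩, propTo, Measure.smul_apply, withDensity_apply _ (hs' x), smul_eq_mul,
        ← mul_assoc, ENNReal.mul_inv_cancel h0 hx.ne, one_mul]
      exact e
  -- Almost sure uniqueness of the disintegration.
  filter_upwards [condDistrib_ae_eq_of_measure_eq_compProd X hZm key, hac.ae_le hκ,
    hac.ae_le hIt, hI0] with x h1 h2 h3 h4
  rw [h1, hKS x ⟨h4, h3.ne⟩, h2]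

lemma of_hasLaw_propTo {W : Ω → α} {f F : α → ℝ} (h : HasLaw W (propTo μ f) P)
    (hF : Measurable F) {c : ℝ} (hc : 0 < c) (hf : ∀ᵐ a ∂μ, f a = c * F a) :
    HasDensityPropTo W μ F P := by
  refine ⟨h.aemeasurable, hF, (∫⁻ a, ENNReal.ofReal (F a) ∂μ)⁻¹, ?_⟩
  rw [h.map_eq, propTo_congr_of_pos hc hf, propTo]

end HasDensityPropTo

end Density

end BLR

noncomputable section

namespace BLR

/-! ### Measurability of matrix operations and of the positive definite cone. -/

section Measurability

variable {α m n l : Type*} [MeasurableSpace α]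

lemma measurable_matrix_iff {f : α → Matrix m n ℝ} :
    Measurable f ↔ ∀ i j, Measurable fun x => f x i j := by
  constructor
  · intro h i j
    exact (measurable_pi_apply j).comp ((measurable_pi_apply i).comp h)
  · intro h
    exact measurable_pi_lambda _ fun i => measurable_pi_lambda _ fun j => h i j

instance instBorelSpaceMatrix [Countable m] [Countable n] : BorelSpace (Matrix m n ℝ) :=
  inferInstanceAs (BorelSpace (m → n → ℝ))

instance instIsAddHaarMeasureMatrix [Fintype m] [Fintype n] :
    (volume : Measure (Matrix m n ℝ)).IsAddHaarMeasure :=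
  Measure.pi.isAddHaarMeasure fun _ : m => (volume : Measure (n → ℝ))

instance instSigmaFiniteMatrix [Fintype m] [Fintype n] :
    SigmaFinite (volume : Measure (Matrix m n ℝ)) :=
  inferInstanceAs (SigmaFinite (volume : Measure (m → n → ℝ)))

lemma _root_.Measurable.matrix_apply {f : α → Matrix m n ℝ} (hf : Measurable f) (i : m) (j : n) :
    Measurable fun x => f x i j :=
  measurable_matrix_iff.1 hf i j

@[fun_prop]
lemma _root_.Measurable.matrix_mul [Fintype n] {f : α → Matrix m n ℝ} {g : α → Matrix n l ℝ}
    (hf : Measurable f) (hg : Measurable g) : Measurable fun x => f x * g x := by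
  refine measurable_matrix_iff.2 fun i j => ?_
  simp only [Matrix.mul_apply]
  fun_prop

@[fun_prop]
lemma _root_.Measurable.matrix_transpose {f : α → Matrix m n ℝ} (hf : Measurable f) :
    Measurable fun x => (f x)ᵀ :=
  measurable_matrix_iff.2 fun i j => hf.matrix_apply j i

@[fun_prop]
lemma _root_.Measurable.matrix_add {f g : α → Matrix m n ℝ} (hf : Measurable f)
    (hg : Measurable g) : Measurable fun x => f x + g x :=
  measurable_matrix_iff.2 fun i j => (hf.matrix_apply i j).add (hg.matrix_apply i j)

@[fun_prop]
lemma _root_.Measurable.matrix_sub {f g : α → Matrix m n ℝ} (hf : Measurable f)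
    (hg : Measurable g) : Measurable fun x => f x - g x :=
  measurable_matrix_iff.2 fun i j => (hf.matrix_apply i j).sub (hg.matrix_apply i j)

@[fun_prop]
lemma _root_.Measurable.matrix_trace [Fintype m] {f : α → Matrix m m ℝ} (hf : Measurable f) :
    Measurable fun x => (f x).trace := by
  simp only [Matrix.trace, Matrix.diag]
  fun_prop

@[fun_prop]
lemma _root_.Measurable.matrix_det [Fintype m] [DecidableEq m] {f : α → Matrix m m ℝ}
    (hf : Measurable f) : Measurable fun x => (f x).det := by
  simp only [Matrix.det_apply']
  fun_prop

@[fun_prop]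
lemma _root_.Measurable.matrix_inv [Fintype m] [DecidableEq m] {f : α → Matrix m m ℝ}
    (hf : Measurable f) : Measurable fun x => (f x)⁻¹ := by
  have hadj : Measurable fun A : Matrix m m ℝ => A.adjugate :=
    (Continuous.matrix_adjugate continuous_id).measurable
  refine measurable_matrix_iff.2 fun i j => ?_
  simp only [Matrix.inv_def, Ring.inverse_eq_inv', Matrix.smul_apply, smul_eq_mul]
  exact hf.matrix_det.inv.mul ((hadj.comp hf).matrix_apply i j)

/-- The cone is the intersection of the closed set of positive semidefinite matrices with the set
where the determinant is nonzero. -/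
lemma measurableSet_posDef [Fintype m] [DecidableEq m] :
    MeasurableSet {V : Matrix m m ℝ | V.PosDef} := by
  have h : {V : Matrix m m ℝ | V.PosDef} =
      {V | V.PosSemidef} ∩ {V | V.det ≠ 0} := by
    ext V
    constructor
    · intro h; exact ⟨h.posSemidef, h.det_pos.ne'⟩
    · rintro ⟨h1, h2⟩; exact h1.posDef_iff_det_ne_zero.2 h2
  rw [h]
  refine MeasurableSet.inter (IsClosed.measurableSet ?_)
    (measurable_id.matrix_det (measurableSet_singleton 0)).compl
  have h2 : {V : Matrix m m ℝ | V.PosSemidef} =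
      {V | Vᵀ = V} ∩ ⋂ x : m → ℝ, {V | 0 ≤ star x ⬝ᵥ (V *ᵥ x)} := by
    ext V
    simp [Matrix.posSemidef_iff_dotProduct_mulVec, Matrix.IsHermitian,
      Matrix.conjTranspose_eq_transpose_of_trivial]
  rw [h2]
  refine (isClosed_eq (by fun_prop) continuous_id).inter (isClosed_iInter fun x => ?_)
  exact isClosed_le continuous_const (by fun_prop)

end Measurability

/-! ### Determinants of linear actions of matrices. -/

section Determinant

variable {m E : Type*} [Fintype m] [DecidableEq m] [AddCommGroup E] [Module ℝ E]

/-- A multiplicative action of matrices by linear maps on which diagonal matrices act with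
determinant `(∏ d) ^ k` has determinant `C.det ^ k` at every invertible `C`: transvections act with
determinant one, being conjugate to their own squares. -/
lemma det_eq_det_pow (ρ : Matrix m m ℝ →* (E →ₗ[ℝ] E)) {k : ℕ}
    (hρ : ∀ d : m → ℝ, LinearMap.det (ρ (diagonal d)) = (∏ i, d i) ^ k)
    {C : Matrix m m ℝ} (hC : C.det ≠ 0) : LinearMap.det (ρ C) = C.det ^ k := by
  refine diagonal_transvection_induction_of_det_ne_zero
    (fun C => LinearMap.det (ρ C) = C.det ^ k) C hC ?_ ?_ ?_
  · intro d _
    rw [hρ, det_diagonal]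
  · rintro ⟨i, j, hij, c⟩
    simp only [TransvectionStruct.toMatrix_mk, det_transvection_of_ne i j hij, one_pow]
    have hmul : ∀ X Y, LinearMap.det (ρ (X * Y)) = LinearMap.det (ρ X) * LinearMap.det (ρ Y) :=
      fun X Y => by rw [map_mul, map_mul]
    have hone : LinearMap.det (ρ 1) = 1 := by rw [map_one, map_one]
    have hne : LinearMap.det (ρ (transvection i j c)) ≠ 0 := by
      intro h0
      have := hmul (transvection i j c) (transvection i j (-c))
      rw [transvection_mul_transvection_same i j hij, add_neg_cancel, transvection_zero, hone, h0,
        zero_mul] at this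
      exact one_ne_zero this
    -- Conjugation by this diagonal matrix doubles the parameter of the transvection, that is,
    -- squares it.
    let d : m → ℝ := Function.update 1 i 2
    have hconj : diagonal d * transvection i j c = transvection i j (c + c) * diagonal d := by
      have hdi : d i = 2 := by simp [d]
      have hdj : d j = 1 := by simp [d, Function.update_of_ne hij.symm]
      simp only [transvection, mul_add, add_mul, mul_one, one_mul]
      congr 1
      ext a b
      simp only [diagonal_mul, mul_diagonal, single_apply]
      split_ifs with h
      · rw [← h.1, ← h.2, hdi, hdj]; ring
      · simp
    have hd : LinearMap.det (ρ (diagonal d)) ≠ 0 := by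
      rw [hρ]
      refine pow_ne_zero _ (Finset.prod_ne_zero_iff.2 fun a _ => ?_)
      by_cases ha : a = i
      · simp [d, ha]
      · simp [d, Function.update_of_ne ha]
    have h1 := congrArg (fun X => LinearMap.det (ρ X)) hconj
    simp only [hmul, ← transvection_mul_transvection_same i j hij] at h1
    -- A nonzero number equal to its own square is 1.
    have h2 : LinearMap.det (ρ (transvection i j c)) =
        LinearMap.det (ρ (transvection i j c)) * LinearMap.det (ρ (transvection i j c)) := by
      apply mul_left_cancel₀ hd
      rw [h1]; ring
    exact (mul_left_cancel₀ hne (by rw [mul_one]; exact h2)).symm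
  · intro A B _ _ hA hB
    rw [map_mul, map_mul, hA, hB, det_mul, mul_pow]

lemma det_pi_smul {ι : Type*} [Fintype ι] [DecidableEq ι] (d : ι → ℝ) (f : (ι → ℝ) →ₗ[ℝ] (ι → ℝ))
    (hf : ∀ x i, f x i = d i * x i) : LinearMap.det f = ∏ i, d i := by
  have : f = Matrix.toLin' (diagonal d) := by
    ext x i
    simp [hf, Matrix.mulVec_diagonal]
  rw [this, LinearMap.det_toLin', det_diagonal]

end Determinant

/-! ### Jacobians of A ↦ CA and V ↦ CVCᵀ. -/

section Jacobian

variable {m n : Type*} [Fintype m] [Fintype n] [DecidableEq m]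

/-- Left multiplication of matrices, on the space of functions of two indices. -/
def mulLeftHom (m n : Type*) [Fintype m] [DecidableEq m] :
    Matrix m m ℝ →* ((m → n → ℝ) →ₗ[ℝ] (m → n → ℝ)) where
  toFun C :=
    { toFun := fun A => (C * (Matrix.of A) : Matrix m n ℝ)
      map_add' := fun A B => by exact Matrix.mul_add C (Matrix.of A) (Matrix.of B)
      map_smul' := fun c A => by exact Matrix.mul_smul C c (Matrix.of A) }
  map_one' := LinearMap.ext fun A => Matrix.one_mul (Matrix.of A)
  map_mul' C D := LinearMap.ext fun A => Matrix.mul_assoc C D (Matrix.of A)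

/-- Each of the n columns contributes one factor |C|. By `det_eq_det_pow` only diagonal matrices
need checking, and these scale the i-th row by `d i`. -/
lemma map_mul_left_volume {C : Matrix m m ℝ} (hC : C.det ≠ 0) :
    (volume : Measure (Matrix m n ℝ)).map (fun A => C * A) =
      ENNReal.ofReal (|C.det ^ Fintype.card n|⁻¹) • volume := by
  classical
  have hdet : LinearMap.det (mulLeftHom m n C) = C.det ^ Fintype.card n := by
    refine det_eq_det_pow _ (fun d => ?_) hC
    have h1 : mulLeftHom m n (diagonal d) =
        LinearMap.pi fun i => (d i • LinearMap.id).comp (LinearMap.proj i) := by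
      refine LinearMap.ext fun A => ?_
      funext i j
      exact Matrix.diagonal_mul d (Matrix.of A) i j
    rw [h1, LinearMap.det_pi, ← Finset.prod_pow]
    simp
  have := Measure.map_linearMap_addHaar_eq_smul_addHaar (volume : Measure (m → n → ℝ))
    (f := mulLeftHom m n C) (by rw [hdet]; exact pow_ne_zero _ hC)
  rw [hdet, abs_inv] at this
  exact this

omit [Fintype m] [DecidableEq m] in
lemma measurable_symOf : Measurable (symOf : (Sym2 m → ℝ) → Matrix m m ℝ) :=
  measurable_matrix_iff.2 fun _ _ => measurable_pi_apply _

/-- The coordinates `v_ij`, for unordered pairs of indices, of the matrix `C * V * Cᵀ`. -/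
def congrHom (m : Type*) [Fintype m] [DecidableEq m] :
    Matrix m m ℝ →* ((Sym2 m → ℝ) →ₗ[ℝ] (Sym2 m → ℝ)) := by
  have hsymm : ∀ (C : Matrix m m ℝ) (x : Sym2 m → ℝ) (i j : m),
      (C * symOf x * Cᵀ) i j = (C * symOf x * Cᵀ) j i := by
    intro C x i j
    have h : (symOf x)ᵀ = symOf x := by
      ext i j
      simp [symOf, Sym2.eq_swap]
    have : (C * symOf x * Cᵀ)ᵀ = C * symOf x * Cᵀ := by
      simp [Matrix.transpose_mul, h, Matrix.mul_assoc]
    exact congrFun (congrFun this.symm i) j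
  let f : Matrix m m ℝ → (Sym2 m → ℝ) → Sym2 m → ℝ := fun C x =>
    Sym2.lift ⟨fun i j => (C * symOf x * Cᵀ) i j, hsymm C x⟩
  have hf : ∀ C x i j, f C x s(i, j) = (C * symOf x * Cᵀ) i j := fun _ _ _ _ => rfl
  have hs : ∀ C x, symOf (f C x) = C * symOf x * Cᵀ := fun _ _ => rfl
  refine ⟨⟨fun C => ⟨⟨f C, fun x y => ?_⟩, fun c x => ?_⟩, ?_⟩, fun C D => ?_⟩
  · have : symOf (x + y) = symOf x + symOf y := rfl
    funext s
    induction s with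
    | _ i j => simp only [Pi.add_apply, hf, this, Matrix.mul_add, Matrix.add_mul, Matrix.add_apply]
  · have : symOf (c • x) = c • symOf x := rfl
    funext s
    induction s with
    | _ i j => simp [hf, this]
  · refine LinearMap.ext fun x => ?_
    funext s
    induction s with
    | _ i j => simp [hf, symOf]
  · refine LinearMap.ext fun x => ?_
    funext s
    induction s with
    | _ i j =>
      change f (C * D) x s(i, j) = f C (f D x) s(i, j)
      simp only [hf, hs, Matrix.transpose_mul, Matrix.mul_assoc]

/-- Represent unordered pairs by pairs with i ≤ j. The factor `d i` occurs once for every j ≥ i and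
once for every j ≤ i; j = i is counted twice, whence the exponent m + 1. -/
lemma prod_sym2_mul [LinearOrder m] (d : m → ℝ) (f : Sym2 m → ℝ)
    (hf : ∀ i j, f s(i, j) = d i * d j) : ∏ s, f s = (∏ i, d i) ^ (Fintype.card m + 1) := by
  have h1 : ∏ s, f s = ∏ p ∈ Finset.univ.filter (fun p : m × m => p.1 ≤ p.2), d p.1 * d p.2 := by
    rw [← Finset.prod_subtype_eq_prod_filter, Finset.subtype_univ]
    refine Fintype.prod_equiv Sym2.sortEquiv _ _ fun s => ?_
    rw [← hf]
    exact congrArg f (Sym2.sortEquiv.symm_apply_apply s).symm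
  have h2 : ∏ p ∈ Finset.univ.filter (fun p : m × m => p.1 ≤ p.2), d p.2 =
      ∏ p ∈ Finset.univ.filter (fun p : m × m => p.2 ≤ p.1), d p.1 := by
    refine Finset.prod_equiv (Equiv.prodComm m m) ?_ ?_ <;> simp
  rw [h1, Finset.prod_mul_distrib, h2, Finset.prod_filter, Finset.prod_filter,
    ← Finset.prod_mul_distrib, Fintype.prod_prod_type, ← Finset.prod_pow]
  refine Finset.prod_congr rfl fun i _ => ?_
  have : ∀ j, ((if i ≤ j then d i else 1) * if j ≤ i then d i else 1) =
      d i * if j = i then d i else 1 := by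
    intro j
    rcases lt_trichotomy i j with h | h | h
    · simp [h.le, h.not_ge, h.ne']
    · simp [h]
    · simp [h.le, h.not_ge, h.ne]
  simp_rw [this, Finset.prod_mul_distrib]
  simp [pow_succ]

lemma det_congrHom {C : Matrix m m ℝ} (hC : C.det ≠ 0) :
    LinearMap.det (congrHom m C) = C.det ^ (Fintype.card m + 1) := by
  refine det_eq_det_pow _ (fun d => ?_) hC
  let f : Sym2 m → ℝ := Sym2.lift ⟨fun i j => d i * d j, fun i j => mul_comm _ _⟩
  rw [det_pi_smul f _ fun x s => ?_]
  · let e := Fintype.equivFin m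
    -- Any order will do; it serves only to enumerate unordered pairs.
    let : LinearOrder m := LinearOrder.lift' e e.injective
    convert! prod_sym2_mul d f fun i j => rfl
  · induction s with
    | _ i j =>
      change (diagonal d * symOf x * (diagonal d)ᵀ) i j = d i * d j * x s(i, j)
      simp [symOf]
      ring

lemma posDef_congr_iff {C V : Matrix m m ℝ} (hC : C.det ≠ 0) :
    (C * V * Cᵀ).PosDef ↔ V.PosDef := by
  have hCu : IsUnit C := (Matrix.isUnit_iff_isUnit_det C).2 hC.isUnit
  rw [← Matrix.conjTranspose_eq_transpose_of_trivial]
  exact hCu.posDef_star_right_conjugate_iff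

/-- The change of variables `V ↦ C * V * Cᵀ` on symmetric matrices. -/
lemma map_congr_posDefVolume {C : Matrix m m ℝ} (hC : C.det ≠ 0) :
    (posDefVolume : Measure (Matrix m m ℝ)).map (fun V => C * V * Cᵀ) =
      ENNReal.ofReal (|C.det ^ (Fintype.card m + 1)|⁻¹) • posDefVolume := by
  have hm : Measurable fun V : Matrix m m ℝ => C * V * Cᵀ := by fun_prop
  have hL : Measurable (congrHom m C) := by
    have : Continuous (congrHom m C) := LinearMap.continuous_of_finiteDimensional _
    exact this.measurable
  have h1 := Measure.map_linearMap_addHaar_eq_smul_addHaar (volume : Measure (Sym2 m → ℝ))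
    (f := congrHom m C) (by rw [det_congrHom hC]; exact pow_ne_zero _ hC)
  rw [det_congrHom hC, abs_inv] at h1
  have h2 : (fun V : Matrix m m ℝ => C * V * Cᵀ) ⁻¹' {V | V.PosDef} = {V | V.PosDef} := by
    ext V
    exact posDef_congr_iff hC
  unfold posDefVolume
  -- Writing the cone as its own preimage lets the restriction pass through the push-forward.
  nth_rewrite 1 [← h2]
  rw [← Measure.restrict_map hm measurableSet_posDef, Measure.map_map hm measurable_symOf]
  have h3 : (fun V : Matrix m m ℝ => C * V * Cᵀ) ∘ symOf = symOf ∘ congrHom m C := rfl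
  rw [h3, ← Measure.map_map measurable_symOf hL, h1, Measure.map_smul, Measure.restrict_smul]

lemma ae_posDef_posDefVolume : ∀ᵐ V ∂(posDefVolume : Measure (Matrix m m ℝ)), V.PosDef :=
  ae_restrict_mem measurableSet_posDef

instance instSFinitePosDefVolume : SFinite (posDefVolume : Measure (Matrix m m ℝ)) := by
  unfold posDefVolume
  infer_instance

-- Supplies the matrix `C` for both substitutions below.
open scoped MatrixOrder in
lemma exists_mul_transpose_eq_of_posDef {V : Matrix m m ℝ} (hV : V.PosDef) :
    ∃ C : Matrix m m ℝ, C.det ≠ 0 ∧ V = C * Cᵀ := by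
  obtain ⟨B, hB⟩ := CStarAlgebra.nonneg_iff_eq_star_mul_self.1 hV.posSemidef.nonneg
  refine ⟨Bᵀ, ?_, ?_⟩
  · intro h0
    have := hV.det_pos
    rw [hB, det_mul, ← det_transpose B, h0, mul_zero] at this
    exact lt_irrefl _ this
  · rw [hB, Matrix.transpose_transpose, Matrix.star_eq_conjTranspose,
      Matrix.conjTranspose_eq_transpose_of_trivial]

end Jacobian

end BLR

end

noncomputable section

namespace BLR

open scoped ENNReal

/-! ### The kernel common to all densities, and its two integrals. -/

section WishartKernel

variable {m n : Type*} [Fintype m] [Fintype n] [DecidableEq m]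

/-- The function `|v| ^ (-r / 2) * exp (- tr (v⁻¹ S) / 2)`, in terms of which the densities of all
normal and inverse Wishart laws are expressed. -/
def wishartKernel (r : ℝ) (S v : Matrix m m ℝ) : ℝ :=
  v.det ^ (-r / 2) * Real.exp (-(1 / 2) * (v⁻¹ * S).trace)

@[fun_prop]
lemma measurable_wishartKernel {α : Type*} [MeasurableSpace α] (r : ℝ) {S v : α → Matrix m m ℝ}
    (hS : Measurable S) (hv : Measurable v) : Measurable fun x => wishartKernel r (S x) (v x) := by
  unfold wishartKernel
  exact (hv.matrix_det.pow_const _).mul ((measurable_const.mul (by fun_prop)).exp)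

lemma wishartKernel_nonneg (r : ℝ) (S : Matrix m m ℝ) {v : Matrix m m ℝ} (hv : v.PosDef) :
    0 ≤ wishartKernel r S v :=
  mul_nonneg (Real.rpow_nonneg hv.det_pos.le _) (Real.exp_pos _).le

/-- This is the conjugacy of the model: prior times likelihood stays in the family. -/
lemma wishartKernel_mul (r s : ℝ) (S T : Matrix m m ℝ) {v : Matrix m m ℝ} (hv : v.PosDef) :
    wishartKernel r S v * wishartKernel s T v = wishartKernel (r + s) (S + T) v := by
  unfold wishartKernel
  rw [mul_mul_mul_comm, ← Real.rpow_add hv.det_pos, ← Real.exp_add, Matrix.mul_add,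
    Matrix.trace_add]
  congr 2 <;> ring

/-- The constant by which integrating out a normal variable multiplies `wishartKernel`. -/
def gaussianConst (m : Type*) [Fintype m] (R : Matrix n n ℝ) : ℝ≥0∞ :=
  ∫⁻ a : Matrix m n ℝ, ENNReal.ofReal (Real.exp (-(1 / 2) * (a * R * aᵀ).trace))

/-- Converts the Jacobian |det C|^k into a half-integer power of det(C Cᵀ). -/
lemma rpow_sq_half_natCast (x : ℝ) (k : ℕ) : (x ^ 2) ^ ((k : ℝ) / 2) = |x ^ k| := by
  rw [← sq_abs, ← Real.rpow_natCast |x| 2, ← Real.rpow_mul (abs_nonneg x), abs_pow,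
    ← Real.rpow_natCast]
  congr 1
  push_cast
  ring

/-- With v = C Cᵀ, substitute a = B + C b. The trace becomes tr(b R bᵀ), free of v and B, and the
Jacobian |det C|^n = |v|^(n/2) lowers `r` by n. Nothing is assumed of `R`: the constant may be
infinite. -/
lemma lintegral_wishartKernel_add_quadratic (r : ℝ) (S : Matrix m m ℝ) (R : Matrix n n ℝ)
    (B : Matrix m n ℝ) {v : Matrix m m ℝ} (hv : v.PosDef) :
    ∫⁻ a, ENNReal.ofReal (wishartKernel r (S + (a - B) * R * (a - B)ᵀ) v) =
      gaussianConst m R * ENNReal.ofReal (wishartKernel (r - Fintype.card n) S v) := by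
  obtain ⟨C, hC, hvC⟩ := exists_mul_transpose_eq_of_posDef hv
  let g : Matrix m n ℝ → ℝ≥0∞ := fun a =>
    ENNReal.ofReal (Real.exp (-(1 / 2) * (a * R * aᵀ).trace))
  have hg : Measurable g := by
    refine Measurable.ennreal_ofReal (Measurable.exp (measurable_const.mul ?_))
    fun_prop
  have e1 : ∀ a, ENNReal.ofReal (wishartKernel r (S + (a - B) * R * (a - B)ᵀ) v) =
      ENNReal.ofReal (wishartKernel r S v) * g (C⁻¹ * (a - B)) := by
    intro a
    rw [← ENNReal.ofReal_mul (wishartKernel_nonneg r S hv)]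
    congr 1
    unfold wishartKernel
    rw [mul_assoc, ← Real.exp_add, Matrix.mul_add, Matrix.trace_add, mul_add]
    congr 4
    rw [hvC, Matrix.mul_inv_rev, Matrix.trace_mul_comm, Matrix.transpose_mul,
      ← Matrix.transpose_nonsing_inv]
    rw [show C⁻¹ * (a - B) * R * ((a - B)ᵀ * C⁻¹ᵀ) = C⁻¹ * ((a - B) * R * (a - B)ᵀ * C⁻¹ᵀ) by
      simp only [Matrix.mul_assoc], Matrix.trace_mul_comm C⁻¹]
    simp only [Matrix.mul_assoc]
  simp_rw [e1]
  have hmeas : Measurable fun a : Matrix m n ℝ => C⁻¹ * a := by fun_prop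
  have hCi : C⁻¹.det ≠ 0 := by
    rw [Matrix.det_nonsing_inv, Ring.inverse_eq_inv']; exact inv_ne_zero hC
  rw [lintegral_const_mul' _ _ ENNReal.ofReal_ne_top,
    lintegral_sub_right_eq_self (fun a => g (C⁻¹ * a)) B, ← lintegral_map hg hmeas,
    map_mul_left_volume hCi, lintegral_smul_measure, smul_eq_mul, ← mul_assoc,
    ← ENNReal.ofReal_mul (wishartKernel_nonneg r S hv), mul_comm]
  congr 2
  unfold wishartKernel
  rw [mul_right_comm]
  congr 1
  have hdet : v.det = C.det ^ 2 := by rw [hvC, det_mul, det_transpose, sq]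
  rw [show -(r - (Fintype.card n : ℝ)) / 2 = -r / 2 + (Fintype.card n : ℝ) / 2 by ring,
    Real.rpow_add hv.det_pos]
  congr 1
  rw [hdet, rpow_sq_half_natCast, Matrix.det_nonsing_inv, Ring.inverse_eq_inv', inv_pow, abs_inv,
    inv_inv]

/-- The constant by which integrating out an inverse Wishart variable multiplies the power of the
determinant. -/
def wishartConst (m : Type*) [Fintype m] [DecidableEq m] (r : ℝ) : ℝ≥0∞ :=
  ∫⁻ v, ENNReal.ofReal (wishartKernel r (1 : Matrix m m ℝ) v) ∂posDefVolume

/-- With S = C Cᵀ, substitute v = C w Cᵀ. The determinant contributes |S|^(-r/2), the Jacobian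
|S|^((m+1)/2), and `S` becomes the identity in the trace. -/
lemma lintegral_wishartKernel (r : ℝ) {S : Matrix m m ℝ} (hS : S.PosDef) :
    ∫⁻ v, ENNReal.ofReal (wishartKernel r S v) ∂posDefVolume =
      wishartConst m r * ENNReal.ofReal (S.det ^ (-(r - Fintype.card m - 1) / 2)) := by
  obtain ⟨C, hC, hSC⟩ := exists_mul_transpose_eq_of_posDef hS
  have hCu : IsUnit C.det := hC.isUnit
  have hmeas : Measurable fun v : Matrix m m ℝ => C * v * Cᵀ := by fun_prop
  have hk : ENNReal.ofReal |C.det ^ (Fintype.card m + 1)| *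
      ENNReal.ofReal (|C.det ^ (Fintype.card m + 1)|⁻¹) = 1 := by
    rw [← ENNReal.ofReal_mul (abs_nonneg _), mul_inv_cancel₀, ENNReal.ofReal_one]
    exact abs_ne_zero.2 (pow_ne_zero _ hC)
  have hpull : (posDefVolume : Measure (Matrix m m ℝ)) =
      ENNReal.ofReal |C.det ^ (Fintype.card m + 1)| •
        posDefVolume.map (fun v => C * v * Cᵀ) := by
    rw [map_congr_posDefVolume hC, smul_smul, hk, one_smul]
  have hdet : S.det = C.det ^ 2 := by rw [hSC, det_mul, det_transpose, sq]
  have hdp := hS.det_pos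
  have e1 : ∀ᵐ v ∂(posDefVolume : Measure (Matrix m m ℝ)),
      ENNReal.ofReal (wishartKernel r S (C * v * Cᵀ)) =
        ENNReal.ofReal (S.det ^ (-r / 2)) * ENNReal.ofReal (wishartKernel r 1 v) := by
    filter_upwards [ae_posDef_posDefVolume] with v hv
    rw [← ENNReal.ofReal_mul (Real.rpow_nonneg hdp.le _)]
    congr 1
    unfold wishartKernel
    rw [← mul_assoc, ← Real.mul_rpow hdp.le hv.det_pos.le]
    congr 2
    · rw [hdet, det_mul, det_mul, det_transpose]
      ring
    · have h1 : C⁻¹ * C = 1 := Matrix.nonsing_inv_mul C hCu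
      have h2 : Cᵀ * Cᵀ⁻¹ = 1 := Matrix.mul_nonsing_inv _ (by rwa [det_transpose])
      congr 1
      rw [hSC, Matrix.mul_inv_rev, Matrix.mul_inv_rev, Matrix.trace_mul_comm]
      rw [show C * Cᵀ * (Cᵀ⁻¹ * (v⁻¹ * C⁻¹)) = C * ((Cᵀ * Cᵀ⁻¹) * v⁻¹ * C⁻¹) by
        simp only [Matrix.mul_assoc], h2, Matrix.one_mul, Matrix.trace_mul_comm, Matrix.mul_assoc,
        h1]
  have hkm : Measurable fun v => ENNReal.ofReal (wishartKernel r S v) :=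
    (measurable_wishartKernel r measurable_const measurable_id).ennreal_ofReal
  nth_rewrite 1 [hpull]
  rw [lintegral_smul_measure, lintegral_map hkm hmeas,
    lintegral_congr_ae e1, lintegral_const_mul' _ _ ENNReal.ofReal_ne_top, smul_eq_mul,
    ← mul_assoc, mul_comm, ← ENNReal.ofReal_mul (abs_nonneg _)]
  unfold wishartConst
  congr 2
  rw [← rpow_sq_half_natCast, ← hdet, ← Real.rpow_add hdp]
  congr 1
  push_cast
  ring

end WishartKernel

/-! ### The laws of the statement in terms of the kernel. -/

section Laws

variable {m n : Type*} [Fintype m] [Fintype n] [DecidableEq m] [DecidableEq n]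

lemma matrixNormalDensity_eq (M : Matrix m n ℝ) (v : Matrix m m ℝ) (K : Matrix n n ℝ)
    (a : Matrix m n ℝ) : matrixNormalDensity M v K a = K.det ^ (-(Fintype.card m : ℝ) / 2) *
      wishartKernel (Fintype.card n) ((a - M) * K⁻¹ * (a - M)ᵀ) v := by
  unfold matrixNormalDensity wishartKernel
  simp only [Matrix.mul_assoc]
  ring

/-- The point is that the normalizing constant depends neither on `M` nor on `v`, so it stays
constant when these are functions of a conditioning variable. -/
lemma matrixNormal_eq_smul_withDensity (M : Matrix m n ℝ) {v : Matrix m m ℝ} (hv : v.PosDef)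
    {K : Matrix n n ℝ} (hK : K.PosDef) :
    matrixNormal M v K = (gaussianConst m K⁻¹)⁻¹ • volume.withDensity fun a =>
      ENNReal.ofReal (wishartKernel (Fintype.card n) ((a - M) * K⁻¹ * (a - M)ᵀ) v) := by
  have h := lintegral_wishartKernel_add_quadratic (Fintype.card n) 0 K⁻¹ M hv
  have h0 : wishartKernel 0 0 v = 1 := by simp [wishartKernel]
  simp only [zero_add, sub_self, h0, ENNReal.ofReal_one, mul_one] at h
  rw [matrixNormal, propTo_congr_of_pos (Real.rpow_pos_of_pos hK.det_pos _)
    (Filter.Eventually.of_forall fun a => matrixNormalDensity_eq M v K a), propTo, h]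

lemma inverseWishartDensity_eq (Ψ : Matrix m m ℝ) (ν : ℝ) (v : Matrix m m ℝ) :
    inverseWishartDensity Ψ ν v =
      Ψ.det ^ ((ν - Fintype.card m - 1) / 2) * wishartKernel ν Ψ v := by
  rw [inverseWishartDensity, wishartKernel, mul_assoc]

omit [DecidableEq m] [DecidableEq n] in
lemma posSemidef_quadratic (X : Matrix m n ℝ) {R : Matrix n n ℝ} (hR : R.PosDef) :
    (X * R * Xᵀ).PosSemidef := by
  have := hR.posSemidef.mul_mul_conjTranspose_same X
  rwa [Matrix.conjTranspose_eq_transpose_of_trivial] at this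

/-- The matrix-T density as a power of `|S + (t - M) R⁻¹ (t - M)ᵀ|`. -/
lemma exists_matrixTDensity_eq (M : Matrix m n ℝ) {S : Matrix m m ℝ} (hS : S.PosDef)
    {R : Matrix n n ℝ} (hR : R.PosDef) (δ : ℝ) : ∃ c : ℝ, 0 < c ∧ ∀ t, matrixTDensity M S R δ t =
      c * (S + (t - M) * R⁻¹ * (t - M)ᵀ).det ^
        (-((δ + Fintype.card n + Fintype.card m - 1) / 2)) := by
  have hSi : 0 < S⁻¹.det := hS.inv.det_pos
  refine ⟨S.det ^ (-(Fintype.card n : ℝ) / 2) * R.det ^ (-(Fintype.card m : ℝ) / 2) *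
    S⁻¹.det ^ (-((δ + Fintype.card n + Fintype.card m - 1) / 2)), ?_, fun t => ?_⟩
  · have := hS.det_pos
    have := hR.det_pos
    positivity
  · have h1 : (1 + S⁻¹ * (t - M) * R⁻¹ * (t - M)ᵀ) =
        S⁻¹ * (S + (t - M) * R⁻¹ * (t - M)ᵀ) := by
      rw [Matrix.mul_add, Matrix.nonsing_inv_mul _ hS.det_pos.ne'.isUnit]
      simp only [Matrix.mul_assoc]
    have h2 := hS.add_posSemidef (posSemidef_quadratic (t - M) hR.inv)
    rw [matrixTDensity, h1, det_mul, Real.mul_rpow hSi.le h2.det_pos.le]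
    ring

end Laws

/-! ### Marginals and reorderings of the variables. -/

section Marginals

variable {m n : Type*} [Fintype m] [Fintype n] [DecidableEq m]
  {Ω α β γ : Type*} [MeasurableSpace Ω] [MeasurableSpace α] [MeasurableSpace β]
  [MeasurableSpace γ] {P : Measure Ω} {μ : Measure α}

/-- Integrating out the row covariance. -/
lemma HasDensityPropTo.fst_posDefVolume [SFinite μ] {W : Ω → α × Matrix m m ℝ} {r : ℝ}
    {S : α → Matrix m m ℝ}
    (h : HasDensityPropTo W (μ.prod posDefVolume) (fun z => wishartKernel r (S z.1) z.2) P)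
    (hSm : Measurable S) (hS : ∀ u, (S u).PosDef) : HasDensityPropTo (fun ω => (W ω).1) μ
      (fun u => (S u).det ^ (-(r - Fintype.card m - 1) / 2)) P := by
  refine h.fst (hSm.matrix_det.pow_const _) (C := wishartConst m r) ?_
  filter_upwards with u
  rw [lintegral_wishartKernel r (hS u)]

/-- Integrating out a conditionally normal matrix. -/
lemma HasDensityPropTo.fst_volume [SFinite μ] {W : Ω → α × Matrix m n ℝ} {r : ℝ}
    {S v : α → Matrix m m ℝ} {R : Matrix n n ℝ} {B : α → Matrix m n ℝ}
    (h : HasDensityPropTo W (μ.prod volume)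
      (fun z => wishartKernel r (S z.1 + (z.2 - B z.1) * R * (z.2 - B z.1)ᵀ) (v z.1)) P)
    (hSm : Measurable S) (hvm : Measurable v) (hv : ∀ᵐ u ∂μ, (v u).PosDef) :
    HasDensityPropTo (fun ω => (W ω).1) μ
      (fun u => wishartKernel (r - Fintype.card n) (S u) (v u)) P := by
  refine h.fst (measurable_wishartKernel _ hSm hvm) (C := gaussianConst m R) ?_
  filter_upwards [hv] with u hu
  exact lintegral_wishartKernel_add_quadratic r (S u) R (B u) hu

variable {ν : Measure β} {τ : Measure γ} [SFinite μ] [SFinite ν] [SFinite τ]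

lemma measurePreserving_prodRotate :
    MeasurePreserving (fun z : (α × β) × γ => ((z.1.2, z.2), z.1.1))
      ((μ.prod ν).prod τ) ((ν.prod τ).prod μ) :=
  Measure.measurePreserving_swap.comp (measurePreserving_prodAssoc μ ν τ)

lemma measurePreserving_prodSwapRight :
    MeasurePreserving (fun z : (α × β) × γ => ((z.1.1, z.2), z.1.2))
      ((μ.prod ν).prod τ) ((μ.prod τ).prod ν) :=
  (measurePreserving_prodRotate (μ := ν) (ν := μ) (τ := τ)).comp
    (Measure.measurePreserving_swap.prod (MeasurePreserving.id τ))

end Marginals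

/-! ### Juxtaposing matrices preserves Lebesgue measure. -/

section FromCols

variable {m n₁ n₂ : Type*} [Fintype m] [Fintype n₁] [Fintype n₂]

lemma measurePreserving_fromCols :
    MeasurePreserving (fun z : Matrix m n₁ ℝ × Matrix m n₂ ℝ => Matrix.fromCols z.1 z.2)
      (volume.prod volume) volume := by
  have h1 : MeasurePreserving
      (MeasurableEquiv.arrowProdEquivProdArrow (n₁ → ℝ) (n₂ → ℝ) m).symm :=
    (volume_measurePreserving_arrowProdEquivProdArrow (n₁ → ℝ) (n₂ → ℝ) m).symm
  have h2 := volume_preserving_pi (fun _ : m =>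
    (volume_measurePreserving_sumPiEquivProdPi (fun _ : n₁ ⊕ n₂ => ℝ)).symm)
  have h3 := h2.comp h1
  convert! h3 using 1

end FromCols

end BLR

end

noncomputable section

namespace BLR

/-! ### Completing squares and block inverses. -/

section Algebra

variable {m n : Type*} [Fintype m] [Fintype n] [DecidableEq m] [DecidableEq n]

omit [Fintype n] [DecidableEq n] in
lemma transpose_eq_of_posDef {S : Matrix n n ℝ} (hS : S.PosDef) : Sᵀ = S := by
  have := hS.isHermitian.eq
  rwa [Matrix.conjTranspose_eq_transpose_of_trivial] at this

omit [Fintype m] [DecidableEq m] [DecidableEq n] in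
lemma mul_mul_transpose_sub (S : Matrix n n ℝ) (hS : Sᵀ = S) (X Z : Matrix m n ℝ) :
    (X - Z) * S * (X - Z)ᵀ = Z * S * Zᵀ + X * S * Xᵀ - (Z * S * Xᵀ + X * (Z * S)ᵀ) := by
  simp only [Matrix.transpose_sub, Matrix.transpose_mul, hS, Matrix.sub_mul, Matrix.mul_sub,
    Matrix.mul_assoc]
  abel

variable {p q N : ℕ} {M : Matrix (Fin p) (Fin q) ℝ} {K : Matrix (Fin q) (Fin q) ℝ}
  {Φ : Matrix (Fin q) (Fin N) ℝ} {D : Matrix (Fin N) (Fin N) ℝ}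

lemma posDef_Sxx (hK : K.PosDef) (hD : D.PosDef) : (Sxx K Φ D).PosDef :=
  hK.inv.add_posSemidef (posSemidef_quadratic Φ hD.inv)

lemma posDef_Pxx (hK : K.PosDef) (hD : D.PosDef) : (Pxx K Φ D).PosDef := by
  have := posSemidef_quadratic Φᵀ hK
  rw [Matrix.transpose_transpose] at this
  exact hD.add_posSemidef this

/-- So S_{y|x,a} is the matrix in the exponent of the joint density of A and Y given V. -/
lemma Sycxa_eq_add (hK : K.PosDef) (hD : D.PosDef) (y : Matrix (Fin p) (Fin N) ℝ)
    (a : Matrix (Fin p) (Fin q) ℝ) : Sycxa M K Φ D y a =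
      (a - M) * K⁻¹ * (a - M)ᵀ + (y - a * Φ) * D⁻¹ * (y - a * Φ)ᵀ := by
  have hK' := transpose_eq_of_posDef hK.inv
  have hD' := transpose_eq_of_posDef hD.inv
  simp only [Sycxa, Syy, Syx, Sxx, Matrix.transpose_sub, Matrix.transpose_mul,
    Matrix.transpose_add, hK', hD', Matrix.sub_mul, Matrix.mul_sub, Matrix.add_mul,
    Matrix.mul_add, Matrix.mul_assoc, Matrix.transpose_transpose]
  abel

/-- Completes the square in `a`: the centre and `Sxx` are the posterior mean and precision, and
`Sycx` is what survives integrating `a` out. -/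
lemma Sycxa_eq_Sycx_add (hK : K.PosDef) (hD : D.PosDef) (y : Matrix (Fin p) (Fin N) ℝ)
    (a : Matrix (Fin p) (Fin q) ℝ) : Sycxa M K Φ D y a = Sycx M K Φ D y +
      (a - Syx M K Φ D y * (Sxx K Φ D)⁻¹) * Sxx K Φ D *
        (a - Syx M K Φ D y * (Sxx K Φ D)⁻¹)ᵀ := by
  have hS : (Sxx K Φ D).PosDef := posDef_Sxx hK hD
  have h1 : Syx M K Φ D y * (Sxx K Φ D)⁻¹ * Sxx K Φ D = Syx M K Φ D y := by
    rw [Matrix.mul_assoc, Matrix.nonsing_inv_mul _ hS.det_pos.ne'.isUnit, Matrix.mul_one]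
  rw [mul_mul_transpose_sub _ (transpose_eq_of_posDef hS), h1, Matrix.transpose_mul,
    transpose_eq_of_posDef hS.inv, Sycxa, Sycx, ← Matrix.mul_assoc]
  abel

/-- In terms of the residual r = y - MΦ one has S_yx = r D⁻¹ Φᵀ + M S_xx, so all terms in M cancel;
what is left is Woodbury's formula for P_xx⁻¹. This form also shows that `Sycx` is positive
semidefinite. -/
lemma Sycx_eq (hK : K.PosDef) (hD : D.PosDef) (y : Matrix (Fin p) (Fin N) ℝ) :
    Sycx M K Φ D y = (y - M * Φ) * (Pxx K Φ D)⁻¹ * (y - M * Φ)ᵀ := by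
  have hS : (Sxx K Φ D).PosDef := posDef_Sxx hK hD
  have hSu := hS.det_pos.ne'.isUnit
  have hP : (Pxx K Φ D)⁻¹ = D⁻¹ - D⁻¹ * Φᵀ * (Sxx K Φ D)⁻¹ * Φ * D⁻¹ :=
    Matrix.add_mul_mul_inv_eq_sub _ _ _ _ hD.isUnit hK.isUnit hS.isUnit
  set r := y - M * Φ with hr
  have hy : y = r + M * Φ := by rw [hr, sub_add_cancel]
  have h1 : Syx M K Φ D y = r * D⁻¹ * Φᵀ + M * Sxx K Φ D := by
    rw [hy]
    simp only [Syx, Sxx, Matrix.add_mul, Matrix.mul_add, Matrix.mul_assoc]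
    abel
  have hS' := transpose_eq_of_posDef hS
  have hD' := transpose_eq_of_posDef hD.inv
  have h2 : Syy M K D y = r * D⁻¹ * rᵀ + r * D⁻¹ * Φᵀ * Mᵀ + M * Φ * D⁻¹ * rᵀ +
      M * Sxx K Φ D * Mᵀ := by
    rw [hy]
    simp only [Syy, Sxx, Matrix.add_mul, Matrix.mul_add, Matrix.mul_assoc, Matrix.transpose_add,
      Matrix.transpose_mul]
    abel
  have h3 : ∀ {l : Type} (Z : Matrix (Fin q) l ℝ), Sxx K Φ D * ((Sxx K Φ D)⁻¹ * Z) = Z := by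
    intro l Z
    rw [← Matrix.mul_assoc, Matrix.mul_nonsing_inv _ hSu, Matrix.one_mul]
  have h4 : ∀ {l : Type} (Z : Matrix (Fin q) l ℝ), (Sxx K Φ D)⁻¹ * (Sxx K Φ D * Z) = Z := by
    intro l Z
    rw [← Matrix.mul_assoc, Matrix.nonsing_inv_mul _ hSu, Matrix.one_mul]
  rw [Sycx, hP, h1, h2]
  simp only [Matrix.add_mul, Matrix.mul_add, Matrix.mul_sub, Matrix.sub_mul, Matrix.mul_assoc,
    Matrix.transpose_add, Matrix.transpose_mul, hS', hD', Matrix.transpose_transpose, h3, h4]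
  abel

lemma posSemidef_Sycx (hK : K.PosDef) (hD : D.PosDef) (y : Matrix (Fin p) (Fin N) ℝ) :
    (Sycx M K Φ D y).PosSemidef := by
  rw [Sycx_eq hK hD]
  exact posSemidef_quadratic _ (posDef_Pxx hK hD).inv

lemma posSemidef_Sycxa (hK : K.PosDef) (hD : D.PosDef) (y : Matrix (Fin p) (Fin N) ℝ)
    (a : Matrix (Fin p) (Fin q) ℝ) : (Sycxa M K Φ D y a).PosSemidef := by
  rw [Sycxa_eq_add hK hD]
  exact (posSemidef_quadratic _ hK.inv).add (posSemidef_quadratic _ hD.inv)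

lemma inv_jointCov (hK : K.PosDef) (hD : D.PosDef) : (jointCov K Φ D)⁻¹ =
    Matrix.fromBlocks (Sxx K Φ D) (-(Φ * D⁻¹)) (-(D⁻¹ * Φᵀ)) D⁻¹ := by
  have hK1 := Matrix.mul_nonsing_inv K hK.det_pos.ne'.isUnit
  have hD1 := Matrix.mul_nonsing_inv D hD.det_pos.ne'.isUnit
  refine Matrix.inv_eq_right_inv ?_
  rw [jointCov, Matrix.fromBlocks_multiply, ← Matrix.fromBlocks_one]
  congr 1 <;>
  simp only [Sxx, Pxx, Matrix.mul_add, Matrix.add_mul, Matrix.mul_neg, hK1, ← Matrix.mul_assoc,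
    Matrix.mul_assoc Φᵀ K K⁻¹, Matrix.mul_one, Matrix.one_mul, hD1] <;> abel

/-- The Schur complement of the block `K` is `D`. -/
lemma posDef_jointCov (hK : K.PosDef) (hD : D.PosDef) : (jointCov K Φ D).PosDef := by
  have : Invertible K := K.invertibleOfIsUnitDet hK.det_pos.ne'.isUnit
  have hK1 := Matrix.mul_nonsing_inv K hK.det_pos.ne'.isUnit
  have h1 : (K * Φ)ᴴ = Φᵀ * K := by
    rw [Matrix.conjTranspose_eq_transpose_of_trivial, Matrix.transpose_mul,
      transpose_eq_of_posDef hK]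
  have hs : Pxx K Φ D - (K * Φ)ᴴ * K⁻¹ * (K * Φ) = D := by
    rw [h1, Pxx]
    simp only [← Matrix.mul_assoc]
    rw [Matrix.mul_assoc Φᵀ K K⁻¹, hK1, Matrix.mul_one, add_sub_cancel_right]
  rw [jointCov, ← h1]
  refine Matrix.PosSemidef.posDef_iff_det_ne_zero ?_ |>.2 ?_
  · rw [Matrix.PosDef.fromBlocks₁₁ _ _ hK, hs]
    exact hD.posSemidef
  · rw [Matrix.det_fromBlocks₁₁, Matrix.invOf_eq_nonsing_inv, hs]
    exact mul_ne_zero hK.det_pos.ne' hD.det_pos.ne'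

lemma quadratic_fromCols (hK : K.PosDef) (hD : D.PosDef) (y : Matrix (Fin p) (Fin N) ℝ)
    (a : Matrix (Fin p) (Fin q) ℝ) :
    (Matrix.fromCols a y - Matrix.fromCols M (M * Φ)) * (jointCov K Φ D)⁻¹ *
      (Matrix.fromCols a y - Matrix.fromCols M (M * Φ))ᵀ =
        (a - M) * K⁻¹ * (a - M)ᵀ + (y - a * Φ) * D⁻¹ * (y - a * Φ)ᵀ := by
  have h1 : Matrix.fromCols a y - Matrix.fromCols M (M * Φ) =
      Matrix.fromCols (a - M) (y - M * Φ) := by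
    ext i j
    rcases j with j | j <;> simp
  have h2 : y - a * Φ = (y - M * Φ) - (a - M) * Φ := by
    rw [Matrix.sub_mul]; abel
  have hD' := transpose_eq_of_posDef hD.inv
  rw [h1, inv_jointCov hK hD, Matrix.fromCols_mul_fromBlocks, Matrix.transpose_fromCols,
    Matrix.fromCols_mul_fromRows, h2]
  generalize a - M = u
  generalize y - M * Φ = w
  simp only [Sxx, Matrix.mul_add, Matrix.add_mul, Matrix.mul_sub, Matrix.sub_mul, Matrix.mul_neg,
    Matrix.neg_mul, Matrix.mul_assoc, Matrix.transpose_sub, Matrix.transpose_mul]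
  abel

end Algebra

/-! ### Matrix-T laws determine their degrees of freedom. -/

section Distinct

variable {m n : Type*} [Fintype m] [Fintype n] [DecidableEq m] [DecidableEq n]

lemma continuous_matrixTDensity (M : Matrix m n ℝ) {S : Matrix m m ℝ} (hS : S.PosDef)
    {R : Matrix n n ℝ} (hR : R.PosDef) (δ : ℝ) : Continuous (matrixTDensity M S R δ) := by
  obtain ⟨c, -, hc⟩ := exists_matrixTDensity_eq M hS hR δ
  rw [funext hc]
  refine continuous_const.mul (Continuous.rpow_const (by fun_prop) fun t => Or.inl ?_)
  exact (hS.add_posSemidef (posSemidef_quadratic (t - M) hR.inv)).det_pos.ne'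

lemma matrixTDensity_pos (M : Matrix m n ℝ) {S : Matrix m m ℝ} (hS : S.PosDef)
    {R : Matrix n n ℝ} (hR : R.PosDef) (δ : ℝ) (t : Matrix m n ℝ) :
    0 < matrixTDensity M S R δ t := by
  obtain ⟨c, hc0, hc⟩ := exists_matrixTDensity_eq M hS hR δ
  rw [hc]
  exact mul_pos hc0 (Real.rpow_pos_of_pos
    (hS.add_posSemidef (posSemidef_quadratic (t - M) hR.inv)).det_pos _)

/-- Along an elementary direction the perturbation of the identity has rank one, so the determinant
is a scalar polynomial in t². -/
lemma matrixTDensity_add_smul_single (M : Matrix m n ℝ) (S : Matrix m m ℝ) (R : Matrix n n ℝ)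
    (δ : ℝ) (i : m) (j : n) (t : ℝ) : matrixTDensity M S R δ (M + t • Matrix.single i j 1) =
      S.det ^ (-(Fintype.card n : ℝ) / 2) * R.det ^ (-(Fintype.card m : ℝ) / 2) *
        (1 + (S⁻¹ i i * R⁻¹ j j) * t ^ 2) ^
          (-((δ + Fintype.card n + Fintype.card m - 1) / 2)) := by
  have h : (1 + S⁻¹ * (M + t • Matrix.single i j 1 - M) * R⁻¹ *
      (M + t • Matrix.single i j 1 - M)ᵀ) = 1 +
      Matrix.replicateCol Unit (fun a => t ^ 2 * R⁻¹ j j * S⁻¹ a i) *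
        Matrix.replicateRow Unit (Pi.single i 1 : m → ℝ) := by
    rw [add_sub_cancel_left]
    congr 1
    ext a b
    simp only [Matrix.mul_apply, Matrix.transpose_apply, Matrix.smul_apply, Matrix.single_apply,
      Finset.univ_unique, Finset.sum_singleton, Matrix.replicateCol_apply,
      Matrix.replicateRow_apply, smul_eq_mul, Pi.single_apply]
    simp only [mul_ite, mul_one, mul_zero, ite_and, Finset.sum_ite_irrel, Finset.sum_ite_eq,
      Finset.mem_univ, if_true, Finset.sum_const_zero, eq_comm (a := i) (b := b)]
    split_ifs
    · simp [ite_mul]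
      ring
    · rfl
  rw [matrixTDensity, h, Matrix.det_one_add_replicateCol_mul_replicateRow]
  congr 3
  simp
  ring

/-- Logarithmic derivatives give aα/(1+αu) = bβ/(1+βu). After clearing denominators, subtracting the
case u = 1 from u = 2 leaves aαβ = bαβ. -/
lemma eq_of_forall_one_add_mul_rpow_eq {α β a b c₁ c₂ : ℝ} (hα : 0 < α) (hβ : 0 < β)
    (hc₁ : 0 < c₁) (hc₂ : 0 < c₂)
    (h : ∀ u : ℝ, 0 < u → c₁ * (1 + α * u) ^ a = c₂ * (1 + β * u) ^ b) : a = b := by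
  have hd : ∀ u : ℝ, 0 < u → a * (α / (1 + α * u)) = b * (β / (1 + β * u)) := by
    intro u hu
    have hp : ∀ γ : ℝ, 0 < γ → ∀ w : ℝ, 0 < w → 0 < 1 + γ * w := fun γ hγ w hw => by positivity
    have hder : ∀ γ s c : ℝ, 0 < γ →
        HasDerivAt (fun w => c + s * Real.log (1 + γ * w)) (s * (γ / (1 + γ * u))) u := by
      intro γ s c hγ
      have h1 : HasDerivAt (fun w : ℝ => 1 + γ * w) γ u := by
        simpa using ((hasDerivAt_id u).const_mul γ).const_add 1
      exact ((h1.log (hp γ hγ u hu).ne').const_mul s).const_add c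
    refine (hder α a (Real.log c₁) hα).unique ((hder β b (Real.log c₂) hβ).congr_of_eventuallyEq ?_)
    filter_upwards [lt_mem_nhds hu] with w hw
    have h1 := congrArg Real.log (h w hw)
    rwa [Real.log_mul hc₁.ne' (Real.rpow_pos_of_pos (hp α hα w hw) _).ne',
      Real.log_mul hc₂.ne' (Real.rpow_pos_of_pos (hp β hβ w hw) _).ne',
      Real.log_rpow (hp α hα w hw), Real.log_rpow (hp β hβ w hw)] at h1
  have h1 := hd 1 one_pos
  have h2 := hd 2 two_pos
  have p1 : 0 < 1 + α * 1 := by positivity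
  have p2 : 0 < 1 + β * 1 := by positivity
  have p3 : 0 < 1 + α * 2 := by positivity
  have p4 : 0 < 1 + β * 2 := by positivity
  field_simp at h1 h2
  have h3 : (a - b) * (α * β) = 0 := by linear_combination h2 - h1
  rcases mul_eq_zero.1 h3 with h | h
  · linarith
  · exact absurd h (by positivity)

/-- Matrix-T laws with different degrees of freedom are different. -/
lemma matrixT_ne [Nonempty m] [Nonempty n] (M : Matrix m n ℝ) {S₁ S₂ : Matrix m m ℝ}
    (hS₁ : S₁.PosDef) (hS₂ : S₂.PosDef) {R : Matrix n n ℝ} (hR : R.PosDef) {δ₁ δ₂ : ℝ}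
    (hδ : δ₁ ≠ δ₂) (h₁ : IsProbabilityMeasure (matrixT M S₁ R δ₁))
    (h₂ : IsProbabilityMeasure (matrixT M S₂ R δ₂)) :
    matrixT M S₁ R δ₁ ≠ matrixT M S₂ R δ₂ := by
  intro heq
  obtain ⟨hz₁, ht₁⟩ := lintegral_ne_of_isProbabilityMeasure_propTo h₁
  obtain ⟨hz₂, ht₂⟩ := lintegral_ne_of_isProbabilityMeasure_propTo h₂
  have hm₁ := (continuous_matrixTDensity M hS₁ hR δ₁).measurable.ennreal_ofReal
  have hm₂ := (continuous_matrixTDensity M hS₂ hR δ₂).measurable.ennreal_ofReal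
  unfold matrixT propTo at heq
  set I₁ := ∫⁻ a, ENNReal.ofReal (matrixTDensity M S₁ R δ₁ a)
  set I₂ := ∫⁻ a, ENNReal.ofReal (matrixTDensity M S₂ R δ₂ a)
  rw [← withDensity_smul _ hm₁, ← withDensity_smul _ hm₂, withDensity_eq_iff_of_sigmaFinite
    (hm₁.const_smul _).aemeasurable (hm₂.const_smul _).aemeasurable] at heq
  have hI₁ : 0 < I₁⁻¹.toReal :=
    ENNReal.toReal_pos (ENNReal.inv_ne_zero.2 ht₁) (ENNReal.inv_ne_top.2 hz₁)
  have hI₂ : 0 < I₂⁻¹.toReal :=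
    ENNReal.toReal_pos (ENNReal.inv_ne_zero.2 ht₂) (ENNReal.inv_ne_top.2 hz₂)
  have hae : (fun t => I₁⁻¹.toReal * matrixTDensity M S₁ R δ₁ t) =ᵐ[volume]
      fun t => I₂⁻¹.toReal * matrixTDensity M S₂ R δ₂ t := by
    filter_upwards [heq] with t ht
    have := congrArg ENNReal.toReal ht
    simpa [ENNReal.toReal_mul, ENNReal.toReal_ofReal (matrixTDensity_pos M hS₁ hR δ₁ t).le,
      ENNReal.toReal_ofReal (matrixTDensity_pos M hS₂ hR δ₂ t).le] using this
  -- Continuous functions that agree almost everywhere agree everywhere, so the densities may be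
  -- compared on a line, a null set in general.
  have hall := (Continuous.ae_eq_iff_eq volume
    (continuous_const.mul (continuous_matrixTDensity M hS₁ hR δ₁))
    (continuous_const.mul (continuous_matrixTDensity M hS₂ hR δ₂))).1 hae
  obtain ⟨i⟩ := ‹Nonempty m›
  obtain ⟨j⟩ := ‹Nonempty n›
  have hRj : 0 < R⁻¹ j j := hR.inv.diag_pos
  have := hS₁.det_pos
  have := hS₂.det_pos
  have := hR.det_pos
  have key := eq_of_forall_one_add_mul_rpow_eq (α := S₁⁻¹ i i * R⁻¹ j j)
    (β := S₂⁻¹ i i * R⁻¹ j j)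
    (a := -((δ₁ + Fintype.card n + Fintype.card m - 1) / 2))
    (b := -((δ₂ + Fintype.card n + Fintype.card m - 1) / 2))
    (c₁ := I₁⁻¹.toReal *
      (S₁.det ^ (-(Fintype.card n : ℝ) / 2) * R.det ^ (-(Fintype.card m : ℝ) / 2)))
    (c₂ := I₂⁻¹.toReal *
      (S₂.det ^ (-(Fintype.card n : ℝ) / 2) * R.det ^ (-(Fintype.card m : ℝ) / 2)))
    (mul_pos hS₁.inv.diag_pos hRj) (mul_pos hS₂.inv.diag_pos hRj) (by positivity) (by positivity)
    (fun u hu => by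
      have h : I₁⁻¹.toReal * matrixTDensity M S₁ R δ₁ (M + Real.sqrt u • Matrix.single i j 1) =
          I₂⁻¹.toReal * matrixTDensity M S₂ R δ₂ (M + Real.sqrt u • Matrix.single i j 1) :=
        congrFun hall _
      rw [matrixTDensity_add_smul_single, matrixTDensity_add_smul_single, Real.sq_sqrt hu.le] at h
      rw [mul_assoc I₁⁻¹.toReal, mul_assoc I₂⁻¹.toReal]
      exact h)
  exact hδ (by linarith)

end Distinct

end BLR

end

noncomputable section

namespace BLR

/-! ### Recognizing the laws from joint kernels. -/

section Conditional

variable {m n : Type*} [Fintype m] [Fintype n] [DecidableEq m] [DecidableEq n]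
  {Ω α : Type*} [MeasurableSpace Ω] [MeasurableSpace α] {P : Measure Ω} [IsProbabilityMeasure P]
  {μ : Measure α}

omit [IsProbabilityMeasure P] in
lemma HasDensityPropTo.of_eq {W : Ω → α} {F G : α → ℝ} (h : HasDensityPropTo W μ F P)
    (hFG : ∀ a, F a = G a) : HasDensityPropTo W μ G P :=
  funext hFG ▸ h

/-- The exponent (r - m - 1)/2 left by integrating out V must equal (δ + n + m - 1)/2. This is `hr`,
and the source of the shift by 2p in all degrees of freedom. -/
lemma HasDensityPropTo.hasLaw_matrixT {W : Ω → Matrix m n ℝ} {M : Matrix m n ℝ}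
    {S : Matrix m m ℝ} {R : Matrix n n ℝ} {r δ : ℝ}
    (h : HasDensityPropTo W volume (fun t => (S + (t - M) * R⁻¹ * (t - M)ᵀ).det ^
      (-(r - Fintype.card m - 1) / 2)) P) (hS : S.PosDef) (hR : R.PosDef)
    (hr : r = δ + Fintype.card n + 2 * Fintype.card m) : HasLaw W (matrixT M S R δ) P := by
  obtain ⟨c, hc0, hc⟩ := exists_matrixTDensity_eq M hS hR δ
  refine h.hasLaw hc0 (Filter.Eventually.of_forall fun t => ?_)
  rw [hc, hr]
  congr 2
  ring

variable [SFinite μ] {X : Ω → α}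

/-- The joint law of `X` and a matrix which is normal given `X`. -/
lemma HasDensityPropTo.prodMk_matrixNormal {Z : Ω → Matrix m n ℝ} {r : ℝ}
    {S v : α → Matrix m m ℝ} {B : α → Matrix m n ℝ} {K : Matrix n n ℝ}
    (hX : HasDensityPropTo X μ (fun x => wishartKernel r (S x) (v x)) P)
    (hZ : HasCondLaw Z X (fun x => matrixNormal (B x) (v x) K) P) (hK : K.PosDef)
    (hS : Measurable S) (hvm : Measurable v) (hB : Measurable B)
    (hv : ∀ᵐ x ∂μ, (v x).PosDef) :
    HasDensityPropTo (fun ω => (X ω, Z ω)) (μ.prod volume)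
      (fun z => wishartKernel (r + Fintype.card n)
        (S z.1 + (z.2 - B z.1) * K⁻¹ * (z.2 - B z.1)ᵀ) (v z.1)) P := by
  have hq : Measurable fun z : α × Matrix m n ℝ => (z.2 - B z.1) * K⁻¹ * (z.2 - B z.1)ᵀ := by
    fun_prop
  have hv1 : Measurable fun z : α × Matrix m n ℝ => v z.1 := by fun_prop
  have hS1 : Measurable fun z : α × Matrix m n ℝ => S z.1 := by fun_prop
  refine hX.prodMk hZ (measurable_wishartKernel (Fintype.card n) hq hv1)
    (C := (gaussianConst m K⁻¹)⁻¹) ?_ (measurable_wishartKernel _ (hS1.matrix_add hq) hv1)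
    (c := 1) one_pos ?_ ?_
  · filter_upwards [hv] with x hx
    exact matrixNormal_eq_smul_withDensity (B x) hx hK
  · filter_upwards [hv] with x hx
    exact wishartKernel_nonneg _ _ hx
  · filter_upwards [hv] with x hx z
    rw [one_mul, wishartKernel_mul _ _ _ _ hx]

lemma HasDensityPropTo.hasCondLaw_inverseWishart {V : Ω → Matrix m m ℝ} {r ν : ℝ}
    {S : α → Matrix m m ℝ}
    (h : HasDensityPropTo (fun ω => (X ω, V ω)) (μ.prod posDefVolume)
      (fun z => wishartKernel r (S z.1) z.2) P) (hS : ∀ x, (S x).PosDef) (hr : r = ν) :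
    HasCondLaw V X (fun x => inverseWishart (S x) ν) P := by
  refine h.hasCondLaw (Filter.Eventually.of_forall fun x => ?_)
  subst hr
  exact (propTo_congr_of_pos (Real.rpow_pos_of_pos (hS x).det_pos _)
    (Filter.Eventually.of_forall fun v => inverseWishartDensity_eq (S x) r v)).symm

lemma HasDensityPropTo.hasCondLaw_matrixNormal {Z : Ω → Matrix m n ℝ} {r : ℝ}
    {S v : α → Matrix m m ℝ} {B : α → Matrix m n ℝ} {K : Matrix n n ℝ}
    (h : HasDensityPropTo (fun ω => (X ω, Z ω)) (μ.prod volume)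
      (fun z => wishartKernel r (S z.1 + (z.2 - B z.1) * K⁻¹ * (z.2 - B z.1)ᵀ) (v z.1)) P)
    (hK : K.PosDef) (hv : ∀ᵐ x ∂μ, (v x).PosDef) :
    HasCondLaw Z X (fun x => matrixNormal (B x) (v x) K) P := by
  refine h.hasCondLaw ?_
  filter_upwards [hv] with x hx
  have h0 : ∀ T, 0 < wishartKernel (r - Fintype.card n) T (v x) := fun T =>
    mul_pos (Real.rpow_pos_of_pos hx.det_pos _) (Real.exp_pos _)
  have hKd := Real.rpow_pos_of_pos hK.det_pos (-(Fintype.card m : ℝ) / 2)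
  -- With `x` frozen, the kernel splits into the normal density and a factor depending on `x` alone,
  -- which normalization absorbs.
  refine propTo_congr_of_pos (div_pos (h0 (S x)) hKd) (Filter.Eventually.of_forall fun z => ?_)
  rw [matrixNormalDensity_eq, ← mul_assoc, div_mul_cancel₀ _ hKd.ne', wishartKernel_mul _ _ _ _ hx,
    sub_add_cancel]

lemma HasDensityPropTo.hasCondLaw_matrixT {Z : Ω → Matrix m n ℝ} {r δ : ℝ}
    {S : α → Matrix m m ℝ} {B : α → Matrix m n ℝ} {R : Matrix n n ℝ}
    (h : HasDensityPropTo (fun ω => (X ω, Z ω)) (μ.prod volume)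
      (fun z => (S z.1 + (z.2 - B z.1) * R⁻¹ * (z.2 - B z.1)ᵀ).det ^
        (-(r - Fintype.card m - 1) / 2)) P)
    (hS : ∀ x, (S x).PosDef) (hR : R.PosDef)
    (hr : r = δ + Fintype.card n + 2 * Fintype.card m) :
    HasCondLaw Z X (fun x => matrixT (B x) (S x) R δ) P := by
  refine h.hasCondLaw (Filter.Eventually.of_forall fun x => ?_)
  obtain ⟨c, hc0, hc⟩ := exists_matrixTDensity_eq (B x) (hS x) hR δ
  refine (propTo_congr_of_pos hc0 (Filter.Eventually.of_forall fun t => ?_)).symm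
  rw [hc, hr]
  congr 2
  ring

lemma HasDensityPropTo.hasCondLaw_normalInverseWishart {A : Ω → Matrix m n ℝ}
    {V : Ω → Matrix m m ℝ} {r ν : ℝ} {S : α → Matrix m m ℝ} {B : α → Matrix m n ℝ}
    {K : Matrix n n ℝ}
    (h : HasDensityPropTo (fun ω => (X ω, (A ω, V ω))) (μ.prod (volume.prod posDefVolume))
      (fun z => wishartKernel r (S z.1 + (z.2.1 - B z.1) * K⁻¹ * (z.2.1 - B z.1)ᵀ) z.2.2) P)
    (hK : K.PosDef) (hS : ∀ x, (S x).PosDef) (hr : r = ν + Fintype.card n) :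
    HasCondLaw (fun ω => (A ω, V ω)) X (fun x => normalInverseWishart (B x) K (S x) ν) P := by
  refine h.hasCondLaw (Filter.Eventually.of_forall fun x => ?_)
  refine (propTo_congr_of_pos
    (mul_pos (Real.rpow_pos_of_pos hK.det_pos (-(Fintype.card m : ℝ) / 2))
      (Real.rpow_pos_of_pos (hS x).det_pos ((ν - Fintype.card m - 1) / 2))) ?_).symm
  filter_upwards [Measure.quasiMeasurePreserving_snd.ae ae_posDef_posDefVolume] with z hz
  rw [matrixNormalDensity_eq, inverseWishartDensity_eq, mul_mul_mul_comm,
    wishartKernel_mul _ _ _ _ hz, hr, add_comm ν, add_comm (S x)]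

end Conditional

/-! ### Joint densities of the model. -/

section Model

variable {p q N L : ℕ} {Φ : Matrix (Fin q) (Fin N) ℝ} {D : Matrix (Fin N) (Fin N) ℝ}
  {Φs : Matrix (Fin q) (Fin L) ℝ} {Ds : Matrix (Fin L) (Fin L) ℝ}
  {M : Matrix (Fin p) (Fin q) ℝ} {K : Matrix (Fin q) (Fin q) ℝ}
  {Ψ : Matrix (Fin p) (Fin p) ℝ} {ν : ℝ}

@[fun_prop]
lemma measurable_Sycx {α : Type*} [MeasurableSpace α] {y : α → Matrix (Fin p) (Fin N) ℝ}
    (hy : Measurable y) : Measurable fun x => Sycx M K Φ D (y x) := by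
  unfold Sycx Syy Syx
  fun_prop

@[fun_prop]
lemma measurable_Sycxa {α : Type*} [MeasurableSpace α] {y : α → Matrix (Fin p) (Fin N) ℝ}
    {a : α → Matrix (Fin p) (Fin q) ℝ} (hy : Measurable y) (ha : Measurable a) :
    Measurable fun x => Sycxa M K Φ D (y x) (a x) := by
  unfold Sycxa Syy Syx
  fun_prop

@[fun_prop]
lemma measurable_Syx {α : Type*} [MeasurableSpace α] {y : α → Matrix (Fin p) (Fin N) ℝ}
    (hy : Measurable y) : Measurable fun x => Syx M K Φ D (y x) := by
  unfold Syx
  fun_prop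

/-- The double inverse matches the shape of the densities, which contain the inverse of the column
covariance, here S_xx⁻¹. -/
lemma Sycxa_eq_Sycx_add_inv (hK : K.PosDef) (hD : D.PosDef) (y : Matrix (Fin p) (Fin N) ℝ)
    (a : Matrix (Fin p) (Fin q) ℝ) : Sycxa M K Φ D y a = Sycx M K Φ D y +
      (a - Syx M K Φ D y * (Sxx K Φ D)⁻¹) * ((Sxx K Φ D)⁻¹)⁻¹ *
        (a - Syx M K Φ D y * (Sxx K Φ D)⁻¹)ᵀ := by
  rw [Matrix.nonsing_inv_nonsing_inv _ (posDef_Sxx hK hD).det_pos.ne'.isUnit,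
    Sycxa_eq_Sycx_add hK hD]

/-- Completing the square in `a` after adding a new observation `s` to the posterior. -/
lemma Sycxa_add_eq (hK : K.PosDef) (hD : D.PosDef) (hDs : Ds.PosDef)
    (y : Matrix (Fin p) (Fin N) ℝ) (a : Matrix (Fin p) (Fin q) ℝ)
    (s : Matrix (Fin p) (Fin L) ℝ) :
    Sycxa M K Φ D y a + (s - a * Φs) * Ds⁻¹ * (s - a * Φs)ᵀ = Sycx M K Φ D y +
      (s - Syx M K Φ D y * (Sxx K Φ D)⁻¹ * Φs) * (Ds + Φsᵀ * (Sxx K Φ D)⁻¹ * Φs)⁻¹ *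
        (s - Syx M K Φ D y * (Sxx K Φ D)⁻¹ * Φs)ᵀ +
      (a - Syx (Syx M K Φ D y * (Sxx K Φ D)⁻¹) (Sxx K Φ D)⁻¹ Φs Ds s *
          (Sxx (Sxx K Φ D)⁻¹ Φs Ds)⁻¹) * Sxx (Sxx K Φ D)⁻¹ Φs Ds *
        (a - Syx (Syx M K Φ D y * (Sxx K Φ D)⁻¹) (Sxx K Φ D)⁻¹ Φs Ds s *
          (Sxx (Sxx K Φ D)⁻¹ Φs Ds)⁻¹)ᵀ := by
  have hS := (posDef_Sxx (Φ := Φ) hK hD).inv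
  -- Sequential updating: the posterior mean and column covariance take the place of `M` and `K`,
  -- and `s` that of the data.
  have h1 := Sycxa_eq_Sycx_add (M := Syx M K Φ D y * (Sxx K Φ D)⁻¹) (Φ := Φs) hS hDs s a
  rw [Sycxa_eq_add hS hDs, Sycx_eq hS hDs] at h1
  rw [Sycxa_eq_Sycx_add_inv hK hD, add_assoc, h1, ← add_assoc]
  rfl

lemma posDef_noiseMatrix {𝒳 : Type*} {σ : 𝒳 → ℝ} (hσ : ∀ x, 0 < σ x) (x : Fin N → 𝒳) :
    (noiseMatrix σ x).PosDef :=
  Matrix.PosDef.diagonal fun i => pow_pos (hσ (x i)) 2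

variable {Ω : Type*} [MeasurableSpace Ω] {P : Measure Ω} [IsProbabilityMeasure P]
  {V : Ω → Matrix (Fin p) (Fin p) ℝ} {A : Ω → Matrix (Fin p) (Fin q) ℝ}
  {Y : Ω → Matrix (Fin p) (Fin N) ℝ} {Ys : Ω → Matrix (Fin p) (Fin L) ℝ}

lemma hasDensityPropTo_weight_cov (hK : K.PosDef) (hΨ : Ψ.PosDef)
    (hV : HasLaw V (inverseWishart Ψ ν) P)
    (hA : HasCondLaw A V (fun v => matrixNormal M v K) P) :
    HasDensityPropTo (fun ω => (A ω, V ω)) (volume.prod posDefVolume)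
      (fun z => wishartKernel (ν + q) (Ψ + (z.1 - M) * K⁻¹ * (z.1 - M)ᵀ) z.2) P := by
  have h0 : HasDensityPropTo V posDefVolume (fun v => wishartKernel ν Ψ v) P :=
    HasDensityPropTo.of_hasLaw_propTo hV
      (measurable_wishartKernel ν measurable_const measurable_id)
      (Real.rpow_pos_of_pos hΨ.det_pos _)
      (Filter.Eventually.of_forall fun v => inverseWishartDensity_eq Ψ ν v)
  have h1 := h0.prodMk_matrixNormal (S := fun _ => Ψ) (v := fun v => v) (B := fun _ => M) hA hK
    measurable_const measurable_id measurable_const ae_posDef_posDefVolume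
  simp only [Fintype.card_fin] at h1
  exact h1.comp Measure.measurePreserving_swap
    (by fun_prop) fun z => rfl

/-- The joint law of A, V and Y, from which the laws involving Y but not Y_* are obtained by
reordering, integrating out and freezing variables. -/
lemma hasDensityPropTo_weight_cov_obs (hK : K.PosDef) (hD : D.PosDef) (hΨ : Ψ.PosDef)
    (hV : HasLaw V (inverseWishart Ψ ν) P)
    (hA : HasCondLaw A V (fun v => matrixNormal M v K) P)
    (hY : HasCondLaw Y (fun ω => (A ω, V ω)) (fun z => matrixNormal (z.1 * Φ) z.2 D) P) :
    HasDensityPropTo (fun ω => ((A ω, V ω), Y ω)) ((volume.prod posDefVolume).prod volume)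
      (fun z => wishartKernel (ν + q + N) (Ψ + Sycxa M K Φ D z.2 z.1.1) z.1.2) P := by
  have h1 := (hasDensityPropTo_weight_cov hK hΨ hV hA).prodMk_matrixNormal
    (S := fun z : Matrix (Fin p) (Fin q) ℝ × Matrix (Fin p) (Fin p) ℝ =>
      Ψ + (z.1 - M) * K⁻¹ * (z.1 - M)ᵀ) (v := Prod.snd)
    (B := fun z : Matrix (Fin p) (Fin q) ℝ × Matrix (Fin p) (Fin p) ℝ => z.1 * Φ)
    hY hD (by fun_prop) measurable_snd (by fun_prop)
    (Measure.quasiMeasurePreserving_snd.ae ae_posDef_posDefVolume)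
  simp only [Fintype.card_fin] at h1
  exact h1.of_eq fun z => by rw [Sycxa_eq_add hK hD, add_assoc Ψ]

omit [IsProbabilityMeasure P] in
lemma hasDensityPropTo_cov_obs_weight (hK : K.PosDef) (hD : D.PosDef)
    (h : HasDensityPropTo (fun ω => ((A ω, V ω), Y ω)) ((volume.prod posDefVolume).prod volume)
      (fun z => wishartKernel (ν + q + N) (Ψ + Sycxa M K Φ D z.2 z.1.1) z.1.2) P) :
    HasDensityPropTo (fun ω => ((V ω, Y ω), A ω)) ((posDefVolume.prod volume).prod volume)
      (fun z => wishartKernel (ν + q + N) (Ψ + Sycx M K Φ D z.1.2 +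
        (z.2 - Syx M K Φ D z.1.2 * (Sxx K Φ D)⁻¹) * ((Sxx K Φ D)⁻¹)⁻¹ *
          (z.2 - Syx M K Φ D z.1.2 * (Sxx K Φ D)⁻¹)ᵀ) z.1.1) P := by
  have h1 : HasDensityPropTo (fun ω => ((V ω, Y ω), A ω))
      ((posDefVolume.prod volume).prod volume)
      (fun z => wishartKernel (ν + q + N) (Ψ + Sycxa M K Φ D z.1.2 z.2) z.1.1) P :=
    h.comp measurePreserving_prodRotate
      (by fun_prop) fun z => rfl
  exact h1.of_eq fun z => by rw [Sycxa_eq_Sycx_add_inv hK hD, add_assoc Ψ]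

omit [IsProbabilityMeasure P] in
lemma hasDensityPropTo_obs_weight_cov
    (h : HasDensityPropTo (fun ω => ((A ω, V ω), Y ω)) ((volume.prod posDefVolume).prod volume)
      (fun z => wishartKernel (ν + q + N) (Ψ + Sycxa M K Φ D z.2 z.1.1) z.1.2) P) :
    HasDensityPropTo (fun ω => ((Y ω, A ω), V ω)) ((volume.prod volume).prod posDefVolume)
      (fun z => wishartKernel (ν + q + N) (Ψ + Sycxa M K Φ D z.1.1 z.1.2) z.2) P :=
  h.comp (measurePreserving_prodRotate.comp measurePreserving_prodRotate)
    (by fun_prop) fun z => rfl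

omit [IsProbabilityMeasure P] in
lemma hasDensityPropTo_obs_weight (hK : K.PosDef) (hD : D.PosDef) (hΨ : Ψ.PosDef)
    (h : HasDensityPropTo (fun ω => ((A ω, V ω), Y ω)) ((volume.prod posDefVolume).prod volume)
      (fun z => wishartKernel (ν + q + N) (Ψ + Sycxa M K Φ D z.2 z.1.1) z.1.2) P) :
    HasDensityPropTo (fun ω => (Y ω, A ω)) (volume.prod volume)
      (fun z => (Ψ + Sycxa M K Φ D z.1 z.2).det ^ (-(ν + q + N - p - 1) / 2)) P := by
  have h1 := (hasDensityPropTo_obs_weight_cov h).fst_posDefVolume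
    (S := fun z : Matrix (Fin p) (Fin N) ℝ × Matrix (Fin p) (Fin q) ℝ => Ψ + Sycxa M K Φ D z.1 z.2)
    (by fun_prop)
    fun u => hΨ.add_posSemidef (posSemidef_Sycxa hK hD _ _)
  simpa only [Fintype.card_fin] using h1

omit [IsProbabilityMeasure P] in
lemma hasDensityPropTo_obs_cov (hK : K.PosDef) (hD : D.PosDef)
    (h : HasDensityPropTo (fun ω => ((A ω, V ω), Y ω)) ((volume.prod posDefVolume).prod volume)
      (fun z => wishartKernel (ν + q + N) (Ψ + Sycxa M K Φ D z.2 z.1.1) z.1.2) P) :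
    HasDensityPropTo (fun ω => (Y ω, V ω)) (volume.prod posDefVolume)
      (fun z => wishartKernel (ν + N) (Ψ + Sycx M K Φ D z.1) z.2) P := by
  have h1 := (hasDensityPropTo_cov_obs_weight hK hD h).fst_volume
    (S := fun u : Matrix (Fin p) (Fin p) ℝ × Matrix (Fin p) (Fin N) ℝ => Ψ + Sycx M K Φ D u.2)
    (v := Prod.fst)
    (B := fun u : Matrix (Fin p) (Fin p) ℝ × Matrix (Fin p) (Fin N) ℝ => Syx M K Φ D u.2 * (Sxx K Φ D)⁻¹)
    (by fun_prop) (by fun_prop)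
    (Measure.quasiMeasurePreserving_fst.ae ae_posDef_posDefVolume)
  rw [Fintype.card_fin, show ν + q + N - q = ν + N by ring] at h1
  exact h1.comp Measure.measurePreserving_swap (by fun_prop) fun z => rfl

lemma hasDensityPropTo_weight_cov_obs_new (hDs : Ds.PosDef)
    (hYs : HasCondLaw Ys (fun ω => (A ω, V ω, Y ω))
      (fun z => matrixNormal (z.1 * Φs) z.2.1 Ds) P)
    (h : HasDensityPropTo (fun ω => ((A ω, V ω), Y ω)) ((volume.prod posDefVolume).prod volume)
      (fun z => wishartKernel (ν + q + N) (Ψ + Sycxa M K Φ D z.2 z.1.1) z.1.2) P) :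
    HasDensityPropTo (fun ω => ((A ω, V ω, Y ω), Ys ω))
      ((volume.prod (posDefVolume.prod volume)).prod volume)
      (fun z => wishartKernel (ν + q + N + L) (Ψ + Sycxa M K Φ D z.1.2.2 z.1.1 +
        (z.2 - z.1.1 * Φs) * Ds⁻¹ * (z.2 - z.1.1 * Φs)ᵀ) z.1.2.1) P := by
  have h0 : HasDensityPropTo (fun ω => (A ω, V ω, Y ω)) (volume.prod (posDefVolume.prod volume))
      (fun z => wishartKernel (ν + q + N) (Ψ + Sycxa M K Φ D z.2.2 z.1) z.2.1) P :=
    h.comp (measurePreserving_prodAssoc _ _ _) (by fun_prop) fun z => rfl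
  have h1 := h0.prodMk_matrixNormal
    (S := fun z : Matrix (Fin p) (Fin q) ℝ × Matrix (Fin p) (Fin p) ℝ × Matrix (Fin p) (Fin N) ℝ =>
      Ψ + Sycxa M K Φ D z.2.2 z.1)
    (v := fun z : Matrix (Fin p) (Fin q) ℝ × Matrix (Fin p) (Fin p) ℝ × Matrix (Fin p) (Fin N) ℝ =>
      z.2.1)
    (B := fun z : Matrix (Fin p) (Fin q) ℝ × Matrix (Fin p) (Fin p) ℝ × Matrix (Fin p) (Fin N) ℝ =>
      z.1 * Φs) hYs hDs
    (by fun_prop)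
    (by fun_prop) (by fun_prop) (Measure.quasiMeasurePreserving_snd.ae
      (Measure.quasiMeasurePreserving_fst.ae ae_posDef_posDefVolume))
  simpa only [Fintype.card_fin] using h1

end Model

end BLR

end

namespace BLR

/-! ### Predictive laws, and the posterior for a known row covariance. -/

section Predictive

variable {p q N L : ℕ} {Φ : Matrix (Fin q) (Fin N) ℝ} {D : Matrix (Fin N) (Fin N) ℝ}
  {Φs : Matrix (Fin q) (Fin L) ℝ} {Ds : Matrix (Fin L) (Fin L) ℝ}
  {M : Matrix (Fin p) (Fin q) ℝ} {K : Matrix (Fin q) (Fin q) ℝ}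
  {Ψ : Matrix (Fin p) (Fin p) ℝ} {ν : ℝ}
  {Ω : Type*} [MeasurableSpace Ω] {P : Measure Ω} [IsProbabilityMeasure P]
  {V : Ω → Matrix (Fin p) (Fin p) ℝ} {A : Ω → Matrix (Fin p) (Fin q) ℝ}
  {Y : Ω → Matrix (Fin p) (Fin N) ℝ} {Ys : Ω → Matrix (Fin p) (Fin L) ℝ}

/-- The predictive law of new observations given the old ones. -/
lemma hasCondLaw_new_obs (hK : K.PosDef) (hD : D.PosDef) (hDs : Ds.PosDef) (hΨ : Ψ.PosDef)
    (h : HasDensityPropTo (fun ω => ((A ω, V ω, Y ω), Ys ω))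
      ((volume.prod (posDefVolume.prod volume)).prod volume)
      (fun z => wishartKernel (ν + q + N + L) (Ψ + Sycxa M K Φ D z.1.2.2 z.1.1 +
        (z.2 - z.1.1 * Φs) * Ds⁻¹ * (z.2 - z.1.1 * Φs)ᵀ) z.1.2.1) P) :
    HasCondLaw Ys Y
      (fun y => matrixT (Syx M K Φ D y * (Sxx K Φ D)⁻¹ * Φs) (Ψ + Sycx M K Φ D y)
        (Ds + Φsᵀ * (Sxx K Φ D)⁻¹ * Φs) (ν + N - 2 * p)) P := by
  have hR : (Ds + Φsᵀ * (Sxx K Φ D)⁻¹ * Φs).PosDef :=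
    posDef_Pxx (Φ := Φs) (posDef_Sxx (Φ := Φ) hK hD).inv hDs
  have h1 : HasDensityPropTo (fun ω => (((V ω, Y ω), Ys ω), A ω))
      (((posDefVolume.prod volume).prod volume).prod volume)
      (fun z => wishartKernel (ν + q + N + L) (Ψ + Sycxa M K Φ D z.1.1.2 z.2 +
        (z.1.2 - z.2 * Φs) * Ds⁻¹ * (z.1.2 - z.2 * Φs)ᵀ) z.1.1.1) P := by
    refine h.comp measurePreserving_prodRotate (by fun_prop) fun z => rfl
  have h2 := h1.of_eq (G := fun z => wishartKernel (ν + q + N + L)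
      (Ψ + Sycx M K Φ D z.1.1.2 + (z.1.2 - Syx M K Φ D z.1.1.2 * (Sxx K Φ D)⁻¹ * Φs) *
        (Ds + Φsᵀ * (Sxx K Φ D)⁻¹ * Φs)⁻¹ *
        (z.1.2 - Syx M K Φ D z.1.1.2 * (Sxx K Φ D)⁻¹ * Φs)ᵀ +
      (z.2 - Syx (Syx M K Φ D z.1.1.2 * (Sxx K Φ D)⁻¹) (Sxx K Φ D)⁻¹ Φs Ds z.1.2 *
          (Sxx (Sxx K Φ D)⁻¹ Φs Ds)⁻¹) * Sxx (Sxx K Φ D)⁻¹ Φs Ds *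
        (z.2 - Syx (Syx M K Φ D z.1.1.2 * (Sxx K Φ D)⁻¹) (Sxx K Φ D)⁻¹ Φs Ds z.1.2 *
          (Sxx (Sxx K Φ D)⁻¹ Φs Ds)⁻¹)ᵀ) z.1.1.1) fun z => by
    rw [add_assoc Ψ, Sycxa_add_eq hK hD hDs, ← add_assoc, ← add_assoc]
  -- Integrates out A, which lowers the exponent by q; integrating out V follows.
  have h3 := HasDensityPropTo.fst_volume
    (α := (Matrix (Fin p) (Fin p) ℝ × Matrix (Fin p) (Fin N) ℝ) × Matrix (Fin p) (Fin L) ℝ)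
    (S := fun u => Ψ + Sycx M K Φ D u.1.2 +
      (u.2 - Syx M K Φ D u.1.2 * (Sxx K Φ D)⁻¹ * Φs) * (Ds + Φsᵀ * (Sxx K Φ D)⁻¹ * Φs)⁻¹ *
        (u.2 - Syx M K Φ D u.1.2 * (Sxx K Φ D)⁻¹ * Φs)ᵀ)
    (v := fun u => u.1.1)
    (B := fun u => Syx (Syx M K Φ D u.1.2 * (Sxx K Φ D)⁻¹) (Sxx K Φ D)⁻¹ Φs Ds u.2 *
      (Sxx (Sxx K Φ D)⁻¹ Φs Ds)⁻¹) h2 (by fun_prop) (by fun_prop)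
    (Measure.quasiMeasurePreserving_fst.ae
      (Measure.quasiMeasurePreserving_fst.ae ae_posDef_posDefVolume))
  have h4 : HasDensityPropTo (fun ω => ((Y ω, Ys ω), V ω))
      ((volume.prod volume).prod posDefVolume)
      (fun z => wishartKernel (ν + q + N + L - Fintype.card (Fin q))
      (Ψ + Sycx M K Φ D z.1.1 + (z.1.2 - Syx M K Φ D z.1.1 * (Sxx K Φ D)⁻¹ * Φs) *
        (Ds + Φsᵀ * (Sxx K Φ D)⁻¹ * Φs)⁻¹ *
        (z.1.2 - Syx M K Φ D z.1.1 * (Sxx K Φ D)⁻¹ * Φs)ᵀ) z.2) P :=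
    h3.comp measurePreserving_prodRotate (by fun_prop) fun z => rfl
  have hS : ∀ y, (Ψ + Sycx M K Φ D y).PosDef := fun y =>
    hΨ.add_posSemidef (posSemidef_Sycx hK hD y)
  have h5 := HasDensityPropTo.fst_posDefVolume
    (α := Matrix (Fin p) (Fin N) ℝ × Matrix (Fin p) (Fin L) ℝ)
    (S := fun z => Ψ + Sycx M K Φ D z.1 + (z.2 - Syx M K Φ D z.1 * (Sxx K Φ D)⁻¹ * Φs) *
        (Ds + Φsᵀ * (Sxx K Φ D)⁻¹ * Φs)⁻¹ *
        (z.2 - Syx M K Φ D z.1 * (Sxx K Φ D)⁻¹ * Φs)ᵀ) h4 (by fun_prop)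
    fun u => (hS _).add_posSemidef (posSemidef_quadratic _ hR.inv)
  refine HasDensityPropTo.hasCondLaw_matrixT (α := Matrix (Fin p) (Fin N) ℝ)
    (S := fun y => Ψ + Sycx M K Φ D y) (B := fun y => Syx M K Φ D y * (Sxx K Φ D)⁻¹ * Φs)
    h5 hS hR ?_
  simp only [Fintype.card_fin]
  ring

/-- The predictive law of new observations given the old ones and the weights. -/
lemma hasCondLaw_new_obs_weight (hK : K.PosDef) (hD : D.PosDef) (hDs : Ds.PosDef) (hΨ : Ψ.PosDef)
    (h : HasDensityPropTo (fun ω => ((A ω, V ω, Y ω), Ys ω))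
      ((volume.prod (posDefVolume.prod volume)).prod volume)
      (fun z => wishartKernel (ν + q + N + L) (Ψ + Sycxa M K Φ D z.1.2.2 z.1.1 +
        (z.2 - z.1.1 * Φs) * Ds⁻¹ * (z.2 - z.1.1 * Φs)ᵀ) z.1.2.1) P) :
    HasCondLaw Ys (fun ω => (Y ω, A ω))
      (fun z => matrixT (z.2 * Φs) (Ψ + Sycxa M K Φ D z.1 z.2) Ds (ν + N + q - 2 * p)) P := by
  have hS : ∀ y a, (Ψ + Sycxa M K Φ D y a).PosDef := fun y a =>
    hΨ.add_posSemidef (posSemidef_Sycxa hK hD y a)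
  have h1 : HasDensityPropTo (fun ω => (((Y ω, A ω), Ys ω), V ω))
      (((volume.prod volume).prod volume).prod posDefVolume)
      (fun z => wishartKernel (ν + q + N + L) (Ψ + Sycxa M K Φ D z.1.1.1 z.1.1.2 +
        (z.1.2 - z.1.1.2 * Φs) * Ds⁻¹ * (z.1.2 - z.1.1.2 * Φs)ᵀ) z.2) P := by
    have he : MeasurePreserving
        (fun z : Matrix (Fin p) (Fin q) ℝ × Matrix (Fin p) (Fin p) ℝ × Matrix (Fin p) (Fin N) ℝ =>
          ((z.2.2, z.1), z.2.1)) (volume.prod (posDefVolume.prod volume))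
        ((volume.prod volume).prod posDefVolume) :=
      measurePreserving_prodRotate.comp Measure.measurePreserving_swap
    refine h.comp (measurePreserving_prodSwapRight.comp (he.prod (MeasurePreserving.id volume)))
      (by fun_prop) fun z => rfl
  have h2 := HasDensityPropTo.fst_posDefVolume
    (α := (Matrix (Fin p) (Fin N) ℝ × Matrix (Fin p) (Fin q) ℝ) × Matrix (Fin p) (Fin L) ℝ)
    (S := fun z => Ψ + Sycxa M K Φ D z.1.1 z.1.2 +
      (z.2 - z.1.2 * Φs) * Ds⁻¹ * (z.2 - z.1.2 * Φs)ᵀ) h1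
    (by fun_prop)
    fun u => (hS _ _).add_posSemidef (posSemidef_quadratic _ hDs.inv)
  refine HasDensityPropTo.hasCondLaw_matrixT
    (α := Matrix (Fin p) (Fin N) ℝ × Matrix (Fin p) (Fin q) ℝ)
    (S := fun z => Ψ + Sycxa M K Φ D z.1 z.2) (B := fun z => z.2 * Φs)
    h2 (fun z => hS z.1 z.2) hDs ?_
  simp only [Fintype.card_fin]
  ring

/-- The predictive law of new observations given the weights only. -/
lemma hasCondLaw_new_weight (hK : K.PosDef) (hD : D.PosDef) (hDs : Ds.PosDef) (hΨ : Ψ.PosDef)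
    (h : HasDensityPropTo (fun ω => ((A ω, V ω, Y ω), Ys ω))
      ((volume.prod (posDefVolume.prod volume)).prod volume)
      (fun z => wishartKernel (ν + q + N + L) (Ψ + Sycxa M K Φ D z.1.2.2 z.1.1 +
        (z.2 - z.1.1 * Φs) * Ds⁻¹ * (z.2 - z.1.1 * Φs)ᵀ) z.1.2.1) P) :
    HasCondLaw Ys A
      (fun a => matrixT (a * Φs) (Ψ + (a - M) * K⁻¹ * (a - M)ᵀ) Ds (ν + q - 2 * p)) P := by
  have hS : ∀ a : Matrix (Fin p) (Fin q) ℝ, (Ψ + (a - M) * K⁻¹ * (a - M)ᵀ).PosDef := fun a =>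
    hΨ.add_posSemidef (posSemidef_quadratic _ hK.inv)
  have h1 : HasDensityPropTo (fun ω => (((A ω, V ω), Ys ω), Y ω))
      (((volume.prod posDefVolume).prod volume).prod volume)
      (fun z => wishartKernel (ν + q + N + L) (Ψ + Sycxa M K Φ D z.2 z.1.1.1 +
        (z.1.2 - z.1.1.1 * Φs) * Ds⁻¹ * (z.1.2 - z.1.1.1 * Φs)ᵀ) z.1.1.2) P := by
    have he : MeasurePreserving
        (fun z : Matrix (Fin p) (Fin q) ℝ × Matrix (Fin p) (Fin p) ℝ × Matrix (Fin p) (Fin N) ℝ =>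
          ((z.1, z.2.1), z.2.2)) (volume.prod (posDefVolume.prod volume))
        ((volume.prod posDefVolume).prod volume) :=
      (measurePreserving_prodAssoc volume posDefVolume volume).symm
    refine h.comp (measurePreserving_prodSwapRight.comp (he.prod (MeasurePreserving.id volume)))
      (by fun_prop) fun z => rfl
  -- Y is to be integrated out, so its square is isolated. Doing so lowers the exponent by N, and N
  -- drops out of the degrees of freedom.
  have h2 := h1.of_eq (G := fun z => wishartKernel (ν + q + N + L)
      (Ψ + (z.1.1.1 - M) * K⁻¹ * (z.1.1.1 - M)ᵀ +
        (z.1.2 - z.1.1.1 * Φs) * Ds⁻¹ * (z.1.2 - z.1.1.1 * Φs)ᵀ +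
        (z.2 - z.1.1.1 * Φ) * D⁻¹ * (z.2 - z.1.1.1 * Φ)ᵀ) z.1.1.2) fun z => by
    rw [Sycxa_eq_add hK hD, ← add_assoc Ψ, add_right_comm (Ψ + _)]
  have h3 := HasDensityPropTo.fst_volume
    (α := (Matrix (Fin p) (Fin q) ℝ × Matrix (Fin p) (Fin p) ℝ) × Matrix (Fin p) (Fin L) ℝ)
    (S := fun u => Ψ + (u.1.1 - M) * K⁻¹ * (u.1.1 - M)ᵀ +
        (u.2 - u.1.1 * Φs) * Ds⁻¹ * (u.2 - u.1.1 * Φs)ᵀ)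
    (v := fun u => u.1.2) (B := fun u => u.1.1 * Φ) h2 (by fun_prop) (by fun_prop)
    (Measure.quasiMeasurePreserving_fst.ae
      (Measure.quasiMeasurePreserving_snd.ae ae_posDef_posDefVolume))
  have h4 : HasDensityPropTo (fun ω => ((A ω, Ys ω), V ω))
      ((volume.prod volume).prod posDefVolume)
      (fun z => wishartKernel (ν + q + N + L - Fintype.card (Fin N))
      (Ψ + (z.1.1 - M) * K⁻¹ * (z.1.1 - M)ᵀ +
        (z.1.2 - z.1.1 * Φs) * Ds⁻¹ * (z.1.2 - z.1.1 * Φs)ᵀ) z.2) P :=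
    h3.comp measurePreserving_prodSwapRight (by fun_prop) fun z => rfl
  have h5 := HasDensityPropTo.fst_posDefVolume
    (α := Matrix (Fin p) (Fin q) ℝ × Matrix (Fin p) (Fin L) ℝ)
    (S := fun z => Ψ + (z.1 - M) * K⁻¹ * (z.1 - M)ᵀ +
        (z.2 - z.1 * Φs) * Ds⁻¹ * (z.2 - z.1 * Φs)ᵀ) h4 (by fun_prop)
    fun u => (hS _).add_posSemidef (posSemidef_quadratic _ hDs.inv)
  refine HasDensityPropTo.hasCondLaw_matrixT (α := Matrix (Fin p) (Fin q) ℝ)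
    (S := fun a => Ψ + (a - M) * K⁻¹ * (a - M)ᵀ) (B := fun a => a * Φs) h5 hS hDs ?_
  simp only [Fintype.card_fin]
  ring

/-- The posterior of the weights in the model with a known row covariance. -/
lemma hasCondLaw_weight_obs_of_known_cov (hK : K.PosDef) (hD : D.PosDef)
    {v : Matrix (Fin p) (Fin p) ℝ} (hv : v.PosDef) (hA : HasLaw A (matrixNormal M v K) P)
    (hY : HasCondLaw Y A (fun a => matrixNormal (a * Φ) v D) P) :
    HasCondLaw A Y
      (fun y => matrixNormal (Syx M K Φ D y * (Sxx K Φ D)⁻¹) v (Sxx K Φ D)⁻¹) P := by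
  have h0 : HasDensityPropTo A volume
      (fun a => wishartKernel q ((a - M) * K⁻¹ * (a - M)ᵀ) v) P := by
    refine HasDensityPropTo.of_hasLaw_propTo hA (by fun_prop)
      (Real.rpow_pos_of_pos hK.det_pos (-(Fintype.card (Fin p) : ℝ) / 2))
      (Filter.Eventually.of_forall fun a => ?_)
    simp only [matrixNormalDensity_eq, Fintype.card_fin]
  have h1 := HasDensityPropTo.prodMk_matrixNormal (α := Matrix (Fin p) (Fin q) ℝ)
    (S := fun a => (a - M) * K⁻¹ * (a - M)ᵀ) (v := fun _ => v)
    (B := fun a => a * Φ) h0 hY hD (by fun_prop) measurable_const (by fun_prop)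
    (Filter.Eventually.of_forall fun _ => hv)
  have h2 := h1.of_eq (G := fun z => wishartKernel (q + Fintype.card (Fin N))
    (Sycx M K Φ D z.2 + (z.1 - Syx M K Φ D z.2 * (Sxx K Φ D)⁻¹) * ((Sxx K Φ D)⁻¹)⁻¹ *
      (z.1 - Syx M K Φ D z.2 * (Sxx K Φ D)⁻¹)ᵀ) v) fun z => by
    rw [← Sycxa_eq_Sycx_add_inv hK hD, Sycxa_eq_add hK hD]
  have h3 : HasDensityPropTo (fun ω => (Y ω, A ω)) (volume.prod volume)
      (fun z => wishartKernel (q + Fintype.card (Fin N))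
      (Sycx M K Φ D z.1 + (z.2 - Syx M K Φ D z.1 * (Sxx K Φ D)⁻¹) * ((Sxx K Φ D)⁻¹)⁻¹ *
      (z.2 - Syx M K Φ D z.1 * (Sxx K Φ D)⁻¹)ᵀ) v) P :=
    h2.comp Measure.measurePreserving_swap (by fun_prop) fun z => rfl
  exact HasDensityPropTo.hasCondLaw_matrixNormal (α := Matrix (Fin p) (Fin N) ℝ)
    (S := fun y => Sycx M K Φ D y) (v := fun _ => v)
    (B := fun y => Syx M K Φ D y * (Sxx K Φ D)⁻¹) h3 (posDef_Sxx hK hD).inv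
    (Filter.Eventually.of_forall fun _ => hv)

end Predictive

/-! ### Prior marginals and posterior laws. -/

section Posterior

variable {p q N : ℕ} {Φ : Matrix (Fin q) (Fin N) ℝ} {D : Matrix (Fin N) (Fin N) ℝ}
  {M : Matrix (Fin p) (Fin q) ℝ} {K : Matrix (Fin q) (Fin q) ℝ}
  {Ψ : Matrix (Fin p) (Fin p) ℝ} {ν : ℝ}
  {Ω : Type*} [MeasurableSpace Ω] {P : Measure Ω} [IsProbabilityMeasure P]
  {V : Ω → Matrix (Fin p) (Fin p) ℝ} {A : Ω → Matrix (Fin p) (Fin q) ℝ}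
  {Y : Ω → Matrix (Fin p) (Fin N) ℝ}

lemma hasLaw_weight (hK : K.PosDef) (hΨ : Ψ.PosDef)
    (h : HasDensityPropTo (fun ω => (A ω, V ω)) (volume.prod posDefVolume)
      (fun z => wishartKernel (ν + q) (Ψ + (z.1 - M) * K⁻¹ * (z.1 - M)ᵀ) z.2) P) :
    HasLaw A (matrixT M Ψ K (ν - 2 * p)) P := by
  have h1 := HasDensityPropTo.fst_posDefVolume (α := Matrix (Fin p) (Fin q) ℝ)
    (S := fun a => Ψ + (a - M) * K⁻¹ * (a - M)ᵀ) h (by fun_prop)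
    fun a => hΨ.add_posSemidef (posSemidef_quadratic _ hK.inv)
  refine HasDensityPropTo.hasLaw_matrixT h1 hΨ hK ?_
  simp only [Fintype.card_fin]
  ring

lemma hasLaw_fromCols (hK : K.PosDef) (hD : D.PosDef) (hΨ : Ψ.PosDef)
    (h : HasDensityPropTo (fun ω => (Y ω, A ω)) (volume.prod volume)
      (fun z => (Ψ + Sycxa M K Φ D z.1 z.2).det ^ (-(ν + q + N - p - 1) / 2)) P) :
    HasLaw (fun ω => Matrix.fromCols (A ω) (Y ω))
      (matrixT (Matrix.fromCols M (M * Φ)) Ψ (jointCov K Φ D) (ν - 2 * p)) P := by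
  have h1 : HasDensityPropTo (fun ω => Matrix.fromCols (A ω) (Y ω)) volume
      (fun t => (Ψ + (t - Matrix.fromCols M (M * Φ)) * (jointCov K Φ D)⁻¹ *
        (t - Matrix.fromCols M (M * Φ))ᵀ).det ^
          (-(ν + q + N - Fintype.card (Fin p) - 1) / 2)) P := by
    refine h.comp (measurePreserving_fromCols.comp Measure.measurePreserving_swap)
      (Measurable.pow_const (by fun_prop) _) fun z => ?_
    rw [Fintype.card_fin, Sycxa_eq_add hK hD, ← quadratic_fromCols hK hD]
    rfl
  refine h1.hasLaw_matrixT hΨ (posDef_jointCov hK hD) ?_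
  simp only [Fintype.card_fin, Fintype.card_sum]
  push_cast
  ring

lemma hasLaw_obs (hK : K.PosDef) (hD : D.PosDef) (hΨ : Ψ.PosDef)
    (h : HasDensityPropTo (fun ω => (Y ω, V ω)) (volume.prod posDefVolume)
      (fun z => wishartKernel (ν + N) (Ψ + Sycx M K Φ D z.1) z.2) P) :
    HasLaw Y (matrixT (M * Φ) Ψ (Pxx K Φ D) (ν - 2 * p)) P := by
  have h1 := HasDensityPropTo.fst_posDefVolume (α := Matrix (Fin p) (Fin N) ℝ)
    (S := fun y => Ψ + Sycx M K Φ D y) h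
    (by fun_prop)
    fun y => hΨ.add_posSemidef (posSemidef_Sycx hK hD y)
  have h2 := h1.of_eq (G := fun y => (Ψ + (y - M * Φ) * (Pxx K Φ D)⁻¹ * (y - M * Φ)ᵀ).det ^
    (-(ν + N - Fintype.card (Fin p) - 1) / 2)) fun y => by rw [Sycx_eq hK hD]
  refine HasDensityPropTo.hasLaw_matrixT h2 hΨ (posDef_Pxx hK hD) ?_
  simp only [Fintype.card_fin]
  ring

lemma hasCondLaw_weight_cov_obs (hK : K.PosDef) (hD : D.PosDef) (hΨ : Ψ.PosDef)
    (h : HasDensityPropTo (fun ω => ((A ω, V ω), Y ω)) ((volume.prod posDefVolume).prod volume)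
      (fun z => wishartKernel (ν + q + N) (Ψ + Sycxa M K Φ D z.2 z.1.1) z.1.2) P) :
    HasCondLaw (fun ω => (A ω, V ω)) Y
      (fun y => normalInverseWishart (Syx M K Φ D y * (Sxx K Φ D)⁻¹) (Sxx K Φ D)⁻¹
        (Ψ + Sycx M K Φ D y) (ν + N)) P := by
  have h1 : HasDensityPropTo (fun ω => (Y ω, (A ω, V ω))) (volume.prod (volume.prod posDefVolume))
      (fun z => wishartKernel (ν + q + N) (Ψ + Sycxa M K Φ D z.1 z.2.1) z.2.2) P :=
    h.comp Measure.measurePreserving_swap (by fun_prop) fun z => rfl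
  have h2 := h1.of_eq (G := fun z => wishartKernel (ν + q + N) (Ψ + Sycx M K Φ D z.1 +
      (z.2.1 - Syx M K Φ D z.1 * (Sxx K Φ D)⁻¹) * ((Sxx K Φ D)⁻¹)⁻¹ *
        (z.2.1 - Syx M K Φ D z.1 * (Sxx K Φ D)⁻¹)ᵀ) z.2.2) fun z => by
    rw [Sycxa_eq_Sycx_add_inv hK hD, add_assoc Ψ]
  refine HasDensityPropTo.hasCondLaw_normalInverseWishart (α := Matrix (Fin p) (Fin N) ℝ)
    (S := fun y => Ψ + Sycx M K Φ D y) (B := fun y => Syx M K Φ D y * (Sxx K Φ D)⁻¹) h2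
    (posDef_Sxx hK hD).inv (fun y => hΨ.add_posSemidef (posSemidef_Sycx hK hD y)) ?_
  simp only [Fintype.card_fin]
  ring

lemma hasCondLaw_weight_obs (hK : K.PosDef) (hD : D.PosDef) (hΨ : Ψ.PosDef)
    (h : HasDensityPropTo (fun ω => (Y ω, A ω)) (volume.prod volume)
      (fun z => (Ψ + Sycxa M K Φ D z.1 z.2).det ^ (-(ν + q + N - p - 1) / 2)) P) :
    HasCondLaw A Y
      (fun y => matrixT (Syx M K Φ D y * (Sxx K Φ D)⁻¹) (Ψ + Sycx M K Φ D y) (Sxx K Φ D)⁻¹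
        (ν + N - 2 * p)) P := by
  have h1 := h.of_eq (G := fun z => (Ψ + Sycx M K Φ D z.1 +
      (z.2 - Syx M K Φ D z.1 * (Sxx K Φ D)⁻¹) * ((Sxx K Φ D)⁻¹)⁻¹ *
        (z.2 - Syx M K Φ D z.1 * (Sxx K Φ D)⁻¹)ᵀ).det ^
      (-(ν + q + N - Fintype.card (Fin p) - 1) / 2)) fun z => by
    rw [Sycxa_eq_Sycx_add_inv hK hD, add_assoc Ψ, Fintype.card_fin]
  refine HasDensityPropTo.hasCondLaw_matrixT (α := Matrix (Fin p) (Fin N) ℝ)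
    (S := fun y => Ψ + Sycx M K Φ D y) (B := fun y => Syx M K Φ D y * (Sxx K Φ D)⁻¹) h1
    (fun y => hΨ.add_posSemidef (posSemidef_Sycx hK hD y)) (posDef_Sxx hK hD).inv ?_
  simp only [Fintype.card_fin]
  ring

lemma hasCondLaw_weight_obs_cov (hK : K.PosDef) (hD : D.PosDef)
    (h : HasDensityPropTo (fun ω => ((V ω, Y ω), A ω)) ((posDefVolume.prod volume).prod volume)
      (fun z => wishartKernel (ν + q + N) (Ψ + Sycx M K Φ D z.1.2 +
        (z.2 - Syx M K Φ D z.1.2 * (Sxx K Φ D)⁻¹) * ((Sxx K Φ D)⁻¹)⁻¹ *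
          (z.2 - Syx M K Φ D z.1.2 * (Sxx K Φ D)⁻¹)ᵀ) z.1.1) P) :
    HasCondLaw A (fun ω => (Y ω, V ω))
      (fun z => matrixNormal (Syx M K Φ D z.1 * (Sxx K Φ D)⁻¹) z.2 (Sxx K Φ D)⁻¹) P := by
  have h1 : HasDensityPropTo (fun ω => ((Y ω, V ω), A ω))
      ((volume.prod posDefVolume).prod volume)
      (fun z => wishartKernel (ν + q + N) (Ψ + Sycx M K Φ D z.1.1 +
        (z.2 - Syx M K Φ D z.1.1 * (Sxx K Φ D)⁻¹) * ((Sxx K Φ D)⁻¹)⁻¹ *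
          (z.2 - Syx M K Φ D z.1.1 * (Sxx K Φ D)⁻¹)ᵀ) z.1.2) P :=
    h.comp (Measure.measurePreserving_swap.prod (MeasurePreserving.id volume)) (by fun_prop)
      fun z => rfl
  exact HasDensityPropTo.hasCondLaw_matrixNormal
    (α := Matrix (Fin p) (Fin N) ℝ × Matrix (Fin p) (Fin p) ℝ)
    (S := fun z => Ψ + Sycx M K Φ D z.1) (v := fun z => z.2)
    (B := fun z => Syx M K Φ D z.1 * (Sxx K Φ D)⁻¹) h1 (posDef_Sxx hK hD).inv
    (Measure.quasiMeasurePreserving_snd.ae ae_posDef_posDefVolume)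

end Posterior

end BLR

theorem theorem4p1 {d p q N L : ℕ}
    -- feature map, noise scale, observed inputs and new inputs
    (φ : EuclideanSpace ℝ (Fin d) → EuclideanSpace ℝ (Fin q))
    (σ : EuclideanSpace ℝ (Fin d) → ℝ) (hσ : ∀ x, 0 < σ x)
    (x : Fin N → EuclideanSpace ℝ (Fin d)) (xs : Fin L → EuclideanSpace ℝ (Fin d))
    -- the associated matrices
    (Φ : Matrix (Fin q) (Fin N) ℝ) (hΦ : Φ = featureMatrix φ x)
    (D : Matrix (Fin N) (Fin N) ℝ) (hD : D = noiseMatrix σ x)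
    (Φs : Matrix (Fin q) (Fin L) ℝ) (hΦs : Φs = featureMatrix φ xs)
    (Ds : Matrix (Fin L) (Fin L) ℝ) (hDs : Ds = noiseMatrix σ xs)
    -- prior parameters
    (M : Matrix (Fin p) (Fin q) ℝ) (K : Matrix (Fin q) (Fin q) ℝ) (hK : K.PosDef)
    (Ψ : Matrix (Fin p) (Fin p) ℝ) (hΨ : Ψ.PosDef) (ν : ℝ) (hν : 2 * (p : ℝ) < ν)
    -- the random matrices and the model
    {Ω : Type*} [MeasurableSpace Ω] (P : Measure Ω) [IsProbabilityMeasure P]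
    (V : Ω → Matrix (Fin p) (Fin p) ℝ) (A : Ω → Matrix (Fin p) (Fin q) ℝ)
    (Y : Ω → Matrix (Fin p) (Fin N) ℝ) (Ys : Ω → Matrix (Fin p) (Fin L) ℝ)
    (hV : HasLaw V (inverseWishart Ψ ν) P)
    (hA : HasCondLaw A V (fun v => matrixNormal M v K) P)
    (hY : HasCondLaw Y (fun ω => (A ω, V ω)) (fun z => matrixNormal (z.1 * Φ) z.2 D) P)
    (hYs : HasCondLaw Ys (fun ω => (A ω, V ω, Y ω))
      (fun z => matrixNormal (z.1 * Φs) z.2.1 Ds) P) :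
    -- joint law of `[A Y]`
    HasLaw (fun ω => Matrix.fromCols (A ω) (Y ω))
      (matrixT (Matrix.fromCols M (M * Φ)) Ψ (jointCov K Φ D) (ν - 2 * p)) P ∧
    -- evidence
    HasLaw Y (matrixT (M * Φ) Ψ (Pxx K Φ D) (ν - 2 * p)) P ∧
    -- marginal of `A`
    HasLaw A (matrixT M Ψ K (ν - 2 * p)) P ∧
    -- joint posterior of `(A, V)` given `Y`, and its two marginals
    HasCondLaw (fun ω => (A ω, V ω)) Y
      (fun y => normalInverseWishart (Syx M K Φ D y * (Sxx K Φ D)⁻¹) (Sxx K Φ D)⁻¹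
        (Ψ + Sycx M K Φ D y) (ν + N)) P ∧
    HasCondLaw A Y
      (fun y => matrixT (Syx M K Φ D y * (Sxx K Φ D)⁻¹) (Ψ + Sycx M K Φ D y) (Sxx K Φ D)⁻¹
        (ν + N - 2 * p)) P ∧
    HasCondLaw V Y (fun y => inverseWishart (Ψ + Sycx M K Φ D y) (ν + N)) P ∧
    -- posterior of `A` given `Y` and `V`
    HasCondLaw A (fun ω => (Y ω, V ω))
      (fun z => matrixNormal (Syx M K Φ D z.1 * (Sxx K Φ D)⁻¹) z.2 (Sxx K Φ D)⁻¹) P ∧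
    -- it is the same as the posterior in the model where `V` is a known matrix `v`
    (∀ v : Matrix (Fin p) (Fin p) ℝ, v.PosDef →
      ∀ (Q : Measure (Matrix (Fin p) (Fin q) ℝ × Matrix (Fin p) (Fin N) ℝ))
        [IsProbabilityMeasure Q],
        HasLaw Prod.fst (matrixNormal M v K) Q →
        HasCondLaw Prod.snd Prod.fst (fun a => matrixNormal (a * Φ) v D) Q →
        HasCondLaw Prod.fst Prod.snd
          (fun y => matrixNormal (Syx M K Φ D y * (Sxx K Φ D)⁻¹) v (Sxx K Φ D)⁻¹) Q) ∧
    -- posterior of `V` given `Y` and `A`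
    HasCondLaw V (fun ω => (Y ω, A ω))
      (fun z => inverseWishart (Ψ + Sycxa M K Φ D z.1 z.2) (ν + N + q)) P ∧
    -- posterior predictive
    HasCondLaw Ys Y
      (fun y => matrixT (Syx M K Φ D y * (Sxx K Φ D)⁻¹ * Φs) (Ψ + Sycx M K Φ D y)
        (Ds + Φsᵀ * (Sxx K Φ D)⁻¹ * Φs) (ν + N - 2 * p)) P ∧
    -- predictive given `Y` and `A`
    HasCondLaw Ys (fun ω => (Y ω, A ω))
      (fun z => matrixT (z.2 * Φs) (Ψ + Sycxa M K Φ D z.1 z.2) Ds (ν + N + q - 2 * p)) P ∧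
    -- predictive given `A` only
    HasCondLaw Ys A
      (fun a => matrixT (a * Φs) (Ψ + (a - M) * K⁻¹ * (a - M)ᵀ) Ds (ν + q - 2 * p)) P ∧
    -- the last two conditional laws are different
    (0 < p → 0 < N → 0 < L →
      ∀ᵐ ω ∂P, condDistrib Ys (fun ω => (Y ω, A ω)) P (Y ω, A ω) ≠
        condDistrib Ys A P (A ω)) := by

  have hDp : D.PosDef := hD ▸ posDef_noiseMatrix hσ x
  have hDsp : Ds.PosDef := hDs ▸ posDef_noiseMatrix hσ xs
  have hAV := hasDensityPropTo_weight_cov hK hΨ hV hA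
  have hAVY := hasDensityPropTo_weight_cov_obs hK hDp hΨ hV hA hY
  have hYA := hasDensityPropTo_obs_weight hK hDp hΨ hAVY
  have hYV := hasDensityPropTo_obs_cov hK hDp hAVY
  have hnew := hasDensityPropTo_weight_cov_obs_new hDsp hYs hAVY
  have hS : ∀ y, (Ψ + Sycx M K Φ D y).PosDef := fun y =>
    hΨ.add_posSemidef (posSemidef_Sycx hK hDp y)
  have hSa : ∀ y a, (Ψ + Sycxa M K Φ D y a).PosDef := fun y a =>
    hΨ.add_posSemidef (posSemidef_Sycxa hK hDp y a)
  have hYsYA := hasCondLaw_new_obs_weight hK hDp hDsp hΨ hnew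
  have hYsA := hasCondLaw_new_weight hK hDp hDsp hΨ hnew
  refine ⟨hasLaw_fromCols hK hDp hΨ hYA, hasLaw_obs hK hDp hΨ hYV, hasLaw_weight hK hΨ hAV,
    hasCondLaw_weight_cov_obs hK hDp hΨ hAVY, hasCondLaw_weight_obs hK hDp hΨ hYA,
    HasDensityPropTo.hasCondLaw_inverseWishart (S := fun y => Ψ + Sycx M K Φ D y) hYV hS rfl,
    hasCondLaw_weight_obs_cov hK hDp (hasDensityPropTo_cov_obs_weight hK hDp hAVY),
    fun v hv Q _ h1 h2 => hasCondLaw_weight_obs_of_known_cov hK hDp hv h1 h2,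
    HasDensityPropTo.hasCondLaw_inverseWishart
      (α := Matrix (Fin p) (Fin N) ℝ × Matrix (Fin p) (Fin q) ℝ)
      (S := fun z => Ψ + Sycxa M K Φ D z.1 z.2) (hasDensityPropTo_obs_weight_cov hAVY)
      (fun z => hSa z.1 z.2) (by ring),
    hasCondLaw_new_obs hK hDp hDsp hΨ hnew, hYsYA, hYsA, fun hp hN hL => ?_⟩
  have : Nonempty (Fin p) := ⟨⟨0, hp⟩⟩
  have : Nonempty (Fin L) := ⟨⟨0, hL⟩⟩
  -- Both formulas hold almost everywhere for the laws of the conditioning variables, hence at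
  -- almost every ω simultaneously.
  filter_upwards [ae_of_ae_map hYsYA.1 hYsYA.2.2, ae_of_ae_map hYsA.1 hYsA.2.2] with ω h1 h2
  rw [h1, h2]
  -- The two matrix-T laws have the same centre and column covariance. They are probability measures
  -- because they are values of Markov kernels.
  refine matrixT_ne _ (hSa _ _) (hΨ.add_posSemidef (posSemidef_quadratic _ hK.inv)) hDsp ?_
    (h1 ▸ inferInstance) (h2 ▸ inferInstance)
  have : (0 : ℝ) < N := by exact_mod_cast hN
  intro h
  linarith
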